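/- Write $\mathbb Z^3_{\le 0}$ for the set of integer points with all coordinates $\le 0$. For $q\in\{a,b,c\}$ and $v=(i,j,k)\in\mathbb Z^3_{\le0}$ let $$r_a(v)=\{(i,j,k),(i,j-1,k),(i,j,k-1),(i,j-1,k-1)\},\quad r_b(v)=\{(i,j,k),(i-1,j,k),(i,j,k-1),(i-1,j,k-1)\},$$ $$r_c(v)=\{(i,j,k),(i-1,j,k),(i,j-1,k),(i-1,j-1,k)\}$$ be the rhombi, with long diagonals $E_a(v)=\{(i,j-1,k),(i,j,k-1)\}$, $E_b(v)=\{(i-1,j,k),(i,j,k-1)\}$, $E_c(v)=\{(i-1,j,k),(i,j-1,k)\}$, and let the short diagonal $e_q(v)$ consist of the two other points of $r_q(v)$. *Groves.* Let $\mathcal L\subseteq\mathbb Z^3_{\le0}$ have finite complement in $\mathbb Z^3_{\le 0}$ and contain, with each point $v$, all $u\le v$ (coordinatewise). Then $\mathcal I=\{v\in\mathcal L: v+(1,1,1)\notin\mathcal L\}$ is called a set of initial conditions. Let $\Gamma_{\mathcal I}$ be the graph on $\mathcal I$ whose edges are the long and short diagonals of the rhombi $r_q(v)\subseteq\mathcal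 I$. An $\mathcal I$-grove is a subgraph $G$ of $\Gamma_{\mathcal I}$ with vertex set $\mathcal I$ such that: exactly one of the two diagonals of each rhombus in $\mathcal I$ is in $G$; for some $N$, every rhombus in $\mathcal I$ all of whose points satisfy $i+j+k<-N$ has its short diagonal in $G$; and for all sufficiently large $N$, every component of $G$ contains exactly one of the following sets and each of these sets is contained in a component of $G$: $\{(0,p,q),(p,0,q)\}$, $\{(p,q,0),(0,q,p)\}$, $\{(q,0,p),(q,p,0)\}$ for $0>p>q$ with $p+q\in\{-N-1,-N-2\}$; $\{(0,p,p),(p,0,p),(p,p,0)\}$ for $2p\in\{-N-1,-N-2\}$; and $\{(0,0,q)\}$, $\{(0,q,0)\}$, $\{(q,0,0)\}$ for $q\le -N-1$. Let $\mathcal G(\mathcal I)$ be the set of $\mathcal I$-groves. *Conductances.* A conductance function $C$ assigns to each diagonal a complex number such that $C(E_q(v))\,C(e_q(v))=1$ for all $q$ and $v\in\mathbb Z^3_{\le 0}$; write $C_q(v)=C(E_q(v))$ and $c_q(v)=C(e_q(v))$. It is $Y$–$\Delta$ consistent if for all $(i,j,k)\in\mathbb Z^3_{\le0}$ the three numbers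 $C_a(i,j,k)c_a(i-1,j,k)$, $C_b(i,j,k)c_b(i,j-1,k)$, $C_c(i,j,k)c_c(i,j,k-1)$ are all equal to $(C_aC_b+C_aC_c+C_bC_c)(i,j,k)$. For $\mu\in\mathbb Z^3_{\le0}$ let $C^\mu_q(v)=C_q(v+\mu)$; this is again a $Y$–$\Delta$ consistent conductance function. *Creation rates.* For $G\in\mathcal G(\mathcal I)$ put $$w(G)=\prod_{E_q(v)\in G}C_q(v),\qquad Z_{\mathcal I}=\sum_{G\in\mathcal G(\mathcal I)}w(G),\qquad \mathbb P_{\mathcal I}(G)=w(G)/Z_{\mathcal I}$$ (a probability measure if $C$ is positive; in general complex weights of total mass $1$). The long edge probabilities are $p(v)=\mathbb P_{\mathcal I}(E_a(v)\in G)$, $q(v)=\mathbb P_{\mathcal I}(E_b(v)\in G)$, $r(v)=\mathbb P_{\mathcal I}(E_c(v)\in G)$, computed on a set of initial conditions $\mathcal I$ that contains $r_a(v)$, $r_b(v)$, $r_c(v)$ respectively, and the creation rates are $E(v)=1-p(v)-q(v)-r(v)$. Let $E^\mu$ be the creation rates for $C^\mu$ and $$F^\mu(x,y,z)=\sum_{i,j,k\ge0}E^\mu(-i,-j,-k)\,x^iy^jz^k\in\mathbb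 C[[x,y,z]].$$ Put $$\Delta(i,j,k)=C_b(i,j-1,k)C_c(i,j,k-1)+C_a(i-1,j,k)C_c(i,j,k-1)+C_a(i-1,j,k)C_b(i,j-1,k),$$ $$U(i,j,k)=\tfrac{C_b(i,j-1,k)C_c(i,j,k-1)}{\Delta(i,j,k)},\quad V(i,j,k)=\tfrac{C_a(i-1,j,k)C_c(i,j,k-1)}{\Delta(i,j,k)},\quad W(i,j,k)=\tfrac{C_a(i-1,j,k)C_b(i,j-1,k)}{\Delta(i,j,k)},$$ and let $U^\mu,V^\mu,W^\mu$ be the same quantities for $C^\mu$. **Theorem.** Let $C$ be a $Y$–$\Delta$ consistent conductance function. For every set of initial conditions $\mathcal I$ there are only finitely many $\mathcal I$-groves and $Z_{\mathcal I}\ne0$, and the long edge probabilities $p(v),q(v),r(v)$ do not depend on the choice of $\mathcal I$. The generating functions satisfy the following infinite system of linear equations: for all $\mu\in\mathbb Z^3_{\le0}$, $$\begin{aligned}F^\mu+xyz\,F^{\mu+(-1,-1,-1)}&-U^\mu(0,0,0)\bigl(x\,F^{\mu+(-1,0,0)}+yz\,F^{\mu+(0,-1,-1)}\bigr)\\&-V^\mu(0,0,0)\bigl(y\,F^{\mu+(0,-1,0)}+xz\,F^{\mu+(-1,0,-1)}\bigr)\\&-W^\mu(0,0,0)\bigl(z\,F^{\mu+(0,0,-1)}+xy\,F^{\mu+(-1,-1,0)}\bigr)=1.\end{aligned}$$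 -/

import Mathlib

open Filter

noncomputable section

namespace Groves

/-- Points `(i, j, k)` of `ℤ³`, with coordinatewise addition and order. The octant `ℤ³_{≤ 0}` is
the set of `v` with `v ≤ 0`. -/
abbrev Vertex : Type := ℤ × ℤ × ℤ

/-- The three kinds of rhombi. -/
inductive Kind : Type
  | a
  | b
  | c

/-- The sum `i + j + k` of the coordinates. -/
def height (v : Vertex) : ℤ := v.1 + v.2.1 + v.2.2

/-- The rhombus `r_q(i,j,k)`, a set of four lattice points. -/
def rhombus : Kind → Vertex → Set Vertex
  | .a, (i, j, k) => {(i, j, k), (i, j - 1, k), (i, j, k - 1), (i, j - 1, k - 1)}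
  | .b, (i, j, k) => {(i, j, k), (i - 1, j, k), (i, j, k - 1), (i - 1, j, k - 1)}
  | .c, (i, j, k) => {(i, j, k), (i - 1, j, k), (i, j - 1, k), (i - 1, j - 1, k)}

/-- The long diagonal `E_q(i,j,k)` of the rhombus `r_q(i,j,k)`, an unordered pair of points. -/
def longDiag : Kind → Vertex → Sym2 Vertex
  | .a, (i, j, k) => s((i, j - 1, k), (i, j, k - 1))
  | .b, (i, j, k) => s((i - 1, j, k), (i, j, k - 1))
  | .c, (i, j, k) => s((i - 1, j, k), (i, j - 1, k))

/-- The short diagonal `e_q(i,j,k)` of the rhombus `r_q(i,j,k)`. -/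
def shortDiag : Kind → Vertex → Sym2 Vertex
  | .a, (i, j, k) => s((i, j, k), (i, j - 1, k - 1))
  | .b, (i, j, k) => s((i, j, k), (i - 1, j, k - 1))
  | .c, (i, j, k) => s((i, j, k), (i - 1, j - 1, k))

/-- The set of all long diagonals of rhombi in the octant. -/
def longDiagonals : Set (Sym2 Vertex) :=
  {d | ∃ q v, v ≤ 0 ∧ d = longDiag q v}

/-! ### Initial conditions and groves -/

/-- `L ⊆ ℤ³_{≤ 0}` has finite complement in the octant and contains the lower cone of each of its
points. -/
structure IsLowerSystem (L : Set Vertex) : Prop where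
  nonpos : ∀ v ∈ L, v ≤ 0
  finite_compl : {v : Vertex | v ≤ 0 ∧ v ∉ L}.Finite
  lower : ∀ v ∈ L, ∀ u ≤ v, u ∈ L

/-- The points `(i,j,k)` of `L` with `(i+1,j+1,k+1) ∉ L`. -/
def boundary (L : Set Vertex) : Set Vertex :=
  {v | v ∈ L ∧ v + (1, 1, 1) ∉ L}

/-- `I` is a set of initial conditions. -/
def IsInitialConditions (I : Set Vertex) : Prop :=
  ∃ L, IsLowerSystem L ∧ I = boundary L

/-- The graph `Γ_I`: its edges are the long and the short diagonals of the rhombi contained in `I`.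
It is regarded as a graph on all of `ℤ³`; the points outside `I` are isolated and play no role. -/
def ambientGraph (I : Set Vertex) : SimpleGraph Vertex :=
  SimpleGraph.fromEdgeSet
    {d | ∃ q v, v ≤ 0 ∧ rhombus q v ⊆ I ∧ (d = longDiag q v ∨ d = shortDiag q v)}

/-- The sets of boundary points prescribed in the connectivity condition of groves, at level `N`. -/
def anchors (N : ℤ) : Set (Set Vertex) :=
  {S | ∃ p q : ℤ, p < 0 ∧ q < p ∧ (p + q = -N - 1 ∨ p + q = -N - 2) ∧
      (S = {(0, p, q), (p, 0, q)} ∨ S = {(p, q, 0), (0, q, p)} ∨ S = {(q, 0, p), (q, p, 0)})} ∪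
  {S | ∃ p : ℤ, (2 * p = -N - 1 ∨ 2 * p = -N - 2) ∧ S = {(0, p, p), (p, 0, p), (p, p, 0)}} ∪
  {S | ∃ q : ℤ, q ≤ -N - 1 ∧ (S = {(0, 0, q)} ∨ S = {(0, q, 0)} ∨ S = {(q, 0, 0)})}

/-- `G` is an `I`-grove: a subgraph of `Γ_I` with vertex set `I` (a subgraph is given by its edges;
the components of `G` are the classes of points of `I` under reachability). -/
structure IsGrove (I : Set Vertex) (G : SimpleGraph Vertex) : Prop where
  /-- `G` is a subgraph of `Γ_I`. -/
  le_ambient : G ≤ ambientGraph I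
  /-- Exactly one of the two diagonals of each rhombus in `I` is an edge of `G`. -/
  complementary : ∀ q v, v ≤ 0 → rhombus q v ⊆ I →
    Xor (longDiag q v ∈ G.edgeSet) (shortDiag q v ∈ G.edgeSet)
  /-- Far away only short diagonals occur. -/
  compact : ∃ N : ℤ, ∀ q v, v ≤ 0 → rhombus q v ⊆ I → (∀ u ∈ rhombus q v, height u < -N) →
    shortDiag q v ∈ G.edgeSet
  /-- For `N` large, every component contains exactly one of the prescribed sets, and each
  prescribed set is contained in a component. -/
  connectivity : ∀ᶠ N : ℤ in atTop,
    (∀ v ∈ I, ∃! S, S ∈ anchors N ∧ ∀ u ∈ S, G.Reachable v u) ∧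
    (∀ S ∈ anchors N, ∃ v ∈ I, ∀ u ∈ S, G.Reachable v u)

/-- The set of all `I`-groves. -/
def groves (I : Set Vertex) : Set (SimpleGraph Vertex) := {G | IsGrove I G}

/-! ### Conductance functions -/

/-- A conductance function: a complex function on the diagonals of the rhombi of the octant (its
values elsewhere play no role), with reciprocal (in particular non-zero) values on the two diagonals
of each rhombus. -/
def IsConductance (C : Sym2 Vertex → ℂ) : Prop :=
  ∀ q v, v ≤ 0 → C (longDiag q v) * C (shortDiag q v) = 1

/-- `C_q(i,j,k)`, the value on the long diagonal. -/
def long (C : Sym2 Vertex → ℂ) (q : Kind) (v : Vertex) : ℂ := C (longDiag q v)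

/-- `c_q(i,j,k)`, the value on the short diagonal. -/
def short (C : Sym2 Vertex → ℂ) (q : Kind) (v : Vertex) : ℂ := C (shortDiag q v)

/-- `C_a C_b + C_a C_c + C_b C_c` at the point `v`. -/
def pairSum (C : Sym2 Vertex → ℂ) (v : Vertex) : ℂ :=
  long C .a v * long C .b v + long C .a v * long C .c v + long C .b v * long C .c v

/-- The `Y-Δ` equations. -/
def IsYDeltaConsistent (C : Sym2 Vertex → ℂ) : Prop :=
  ∀ v : Vertex, v ≤ 0 →
    long C .a v * short C .a (v + (-1, 0, 0)) = pairSum C v ∧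
    long C .b v * short C .b (v + (0, -1, 0)) = pairSum C v ∧
    long C .c v * short C .c (v + (0, 0, -1)) = pairSum C v

/-- The translate `C^μ`, with `C^μ_q(v) = C_q(v + μ)` (and likewise on short diagonals). -/
def translate (C : Sym2 Vertex → ℂ) (μ : Vertex) : Sym2 Vertex → ℂ :=
  fun d => C (d.map (· + μ))

/-- `Δ(i,j,k)`. -/
def delta (C : Sym2 Vertex → ℂ) (v : Vertex) : ℂ :=
  long C .b (v + (0, -1, 0)) * long C .c (v + (0, 0, -1)) +
  long C .a (v + (-1, 0, 0)) * long C .c (v + (0, 0, -1)) +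
  long C .a (v + (-1, 0, 0)) * long C .b (v + (0, -1, 0))

/-- The coefficient `U(i,j,k)`. -/
def coeffU (C : Sym2 Vertex → ℂ) (v : Vertex) : ℂ :=
  long C .b (v + (0, -1, 0)) * long C .c (v + (0, 0, -1)) / delta C v

/-- The coefficient `V(i,j,k)`. -/
def coeffV (C : Sym2 Vertex → ℂ) (v : Vertex) : ℂ :=
  long C .a (v + (-1, 0, 0)) * long C .c (v + (0, 0, -1)) / delta C v

/-- The coefficient `W(i,j,k)`. -/
def coeffW (C : Sym2 Vertex → ℂ) (v : Vertex) : ℂ :=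
  long C .a (v + (-1, 0, 0)) * long C .b (v + (0, -1, 0)) / delta C v

/-! ### The Boltzmann measures, edge probabilities and creation rates -/

/-- The weight of a grove: the product of the conductances of its long edges (a grove has only
finitely many of them). -/
def weight (C : Sym2 Vertex → ℂ) (G : SimpleGraph Vertex) : ℂ :=
  ∏ᶠ d ∈ longDiagonals ∩ G.edgeSet, C d

/-- The partition function `Z_I`. -/
def partitionFunction (C : Sym2 Vertex → ℂ) (I : Set Vertex) : ℂ :=
  ∑ᶠ G ∈ groves I, weight C G

/-- The Boltzmann weight `ℙ_I(G)` of a grove. It is a probability when `C` is positive. -/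
def groveProb (C : Sym2 Vertex → ℂ) (I : Set Vertex) (G : SimpleGraph Vertex) : ℂ :=
  weight C G / partitionFunction C I

/-- `ℙ_I(E_q(v) ∈ G)`, for an `I`-grove `G` distributed according to `ℙ_I`. -/
def longProbOn (C : Sym2 Vertex → ℂ) (I : Set Vertex) (q : Kind) (v : Vertex) : ℂ :=
  ∑ᶠ G ∈ {G | G ∈ groves I ∧ longDiag q v ∈ G.edgeSet}, groveProb C I G

/-- The unit vector normal to the rhombi of kind `q`. -/
def unit : Kind → Vertex
  | .a => (1, 0, 0)
  | .b => (0, 1, 0)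
  | .c => (0, 0, 1)

/-- A set of initial conditions that contains the rhombus `r_q(v)`: the one obtained by removing
the points of the octant that dominate `v + unit q`. -/
def standardConditions (q : Kind) (v : Vertex) : Set Vertex :=
  boundary {u | u ≤ 0 ∧ ¬ (v + unit q ≤ u)}

theorem isInitialConditions_standardConditions (q : Kind) (v : Vertex) :
    IsInitialConditions (standardConditions q v) := by
  refine ⟨_, ⟨fun u hu => hu.1, ?_, ?_⟩, rfl⟩
  · refine (Set.finite_Icc (v + unit q) 0).subset ?_
    rintro u ⟨h0, h⟩
    refine ⟨?_, h0⟩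
    by_contra h'
    exact h ⟨h0, h'⟩
  · rintro w ⟨h0, h⟩ u hu
    exact ⟨hu.trans h0, fun h' => h (h'.trans hu)⟩

theorem rhombus_subset_standardConditions (q : Kind) (v : Vertex) (hv : v ≤ 0) :
    rhombus q v ⊆ standardConditions q v := by
  obtain ⟨i, j, k⟩ := v
  cases q <;>
  · rintro ⟨a, b, c⟩ h
    simp only [rhombus, Set.mem_insert_iff, Set.mem_singleton_iff, Prod.mk.injEq] at h
    simp only [standardConditions, boundary, unit, Set.mem_ofPred_eq, Prod.mk_add_mk,
      Prod.le_def, Prod.fst_zero, Prod.snd_zero] at hv ⊢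
    omega

/-- The long edge probabilities `p(v)`, `q(v)`, `r(v)` (for the kinds `a`, `b`, `c`), computed on
one set of initial conditions that contains the rhombus. -/
def longProb (C : Sym2 Vertex → ℂ) (q : Kind) (v : Vertex) : ℂ :=
  longProbOn C (standardConditions q v) q v

/-- The creation rate `E(v) = 1 - p(v) - q(v) - r(v)`. -/
def creationRate (C : Sym2 Vertex → ℂ) (v : Vertex) : ℂ :=
  1 - longProb C .a v - longProb C .b v - longProb C .c v

/-- The generating function `F^μ = ∑ E^μ(-i,-j,-k) x^i y^j z^k`, where `E^μ` are the creation rates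
of `C^μ`. The variables `x`, `y`, `z` are `X 0`, `X 1`, `X 2`. -/
def genFun (C : Sym2 Vertex → ℂ) (μ : Vertex) : MvPowerSeries (Fin 3) ℂ :=
  fun n => creationRate (translate C μ) (-(n 0 : ℤ), -(n 1 : ℤ), -(n 2 : ℤ))

end Groves

end

namespace Groves

/-! ### Kinds and diagonals -/

/-! Every lower system `L` arises from the octant by successively deleting maximal points
(`lowerSystem_induction`). Deleting a maximal point `v` replaces `v` by `v - (1, 1, 1)` in the
boundary, and the three rhombi at the top of the unit cube below `v` by the three at its bottom. On
diagonals this is a star-triangle exchange: the short diagonals are the rays of a star, the long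
ones the sides of a triangle. It preserves connectivity away from the two centres, so groves before
and after can be grouped by their part outside the cube (`IsTop.exists_sums`), and the `Y`-`Δ`
equations make the weight sums of matching groups proportional, with the non-zero factor `pairSum C
v` (`IsTop.sum_eq_pairSum_mul`). On the octant itself the only grove consists of short diagonals
(`configs_Iic`), and the partition function is `1`. Induction gives finiteness and non-vanishing;
since a move does not affect the probabilities at rhombi outside the cube, it also gives
independence of the initial conditions.

Inside the cube the same comparison yields the recursion `p_q(v - unit q) = p_q(v) + (1 - coeff C q
v) * E(v)` (`longProb_sub_unit`), while `p_q` vanishes where `coord q v = 0` (`longProb_eq_zero`).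

For the linear system, the quantities of the translate with apex `ν` are read at the absolute point
`u = v + ν`. The coefficient of the recursion then depends on `u` alone, so a linear combination
over apexes, taken at fixed `u`, obeys the same recursion. For the eight apexes and the coefficients
of the system, the indicators of `u ≤ ν` nearly cancel because `U + V + W = 1`, and descending
induction from `μ` shows that the combination of rates is `1` at `u = μ` and `0` elsewhere
(`cubeComb_apex`). These values are the coefficients of the power series identity. -/

instance : DecidableEq Kind := fun x y => by
  cases x <;> cases y <;> first | exact isTrue rfl | exact isFalse (by simp)

instance : Fintype Kind := ⟨{.a, .b, .c}, by rintro (_ | _ | _) <;> simp⟩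

theorem sum_kind {M : Type*} [AddCommMonoid M] (f : Kind → M) :
    ∑ q, f q = f .a + f .b + f .c := by
  have : (Finset.univ : Finset Kind) = {.a, .b, .c} := rfl
  rw [this, Finset.sum_insert (by decide), Finset.sum_insert (by decide), Finset.sum_singleton,
    add_assoc]

theorem sum_finset_kind {M : Type*} [AddCommMonoid M] (f : Finset Kind → M) :
    ∑ S, f S = f ∅ + ∑ q, f {q} + ∑ q, f {q}ᶜ + f Finset.univ := by
  have : (Finset.univ : Finset (Finset Kind)) =
    {∅, {.a}, {.b}, {.c}, {.a}ᶜ, {.b}ᶜ, {.c}ᶜ, Finset.univ} := by decide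
  rw [this]
  repeat rw [Finset.sum_insert (by decide)]
  rw [Finset.sum_singleton, sum_kind, sum_kind]
  simp only [add_assoc]

/-- The cyclic successor of a kind. -/
def Kind.next : Kind → Kind
  | .a => .b
  | .b => .c
  | .c => .a

/-- The cyclic predecessor of a kind. -/
def Kind.prev : Kind → Kind
  | .a => .c
  | .b => .a
  | .c => .b

@[simp] theorem Kind.next_next (q : Kind) : q.next.next = q.prev := by cases q <;> rfl
@[simp] theorem Kind.prev_prev (q : Kind) : q.prev.prev = q.next := by cases q <;> rfl
@[simp] theorem Kind.next_prev (q : Kind) : q.next.prev = q := by cases q <;> rfl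
@[simp] theorem Kind.prev_next (q : Kind) : q.prev.next = q := by cases q <;> rfl
theorem Kind.next_ne (q : Kind) : q.next ≠ q := by cases q <;> simp [Kind.next]
theorem Kind.prev_ne (q : Kind) : q.prev ≠ q := by cases q <;> simp [Kind.prev]
theorem Kind.next_ne_prev (q : Kind) : q.next ≠ q.prev := by cases q <;> simp [Kind.next, Kind.prev]

theorem Kind.eq_or (q r : Kind) : r = q ∨ r = q.next ∨ r = q.prev := by
  cases q <;> cases r <;> simp [Kind.next, Kind.prev]

theorem Kind.compl_singleton (q : Kind) : ({q}ᶜ : Finset Kind) = {q.next, q.prev} := by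
  cases q <;> decide

theorem longDiag_eq (q : Kind) (v : Vertex) :
    longDiag q v = s(v - unit q.next, v - unit q.prev) := by
  obtain ⟨i, j, k⟩ := v
  cases q <;> simp [longDiag, unit, Kind.next, Kind.prev, Sym2.eq_swap]

theorem shortDiag_eq (q : Kind) (v : Vertex) :
    shortDiag q v = s(v, v - unit q.next - unit q.prev) := by
  obtain ⟨i, j, k⟩ := v
  cases q <;> simp [shortDiag, unit, Kind.next, Kind.prev]

theorem longDiag_ne_shortDiag (q q' : Kind) (v v' : Vertex) :
    longDiag q v ≠ shortDiag q' v' := by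
  obtain ⟨i, j, k⟩ := v
  obtain ⟨i', j', k'⟩ := v'
  cases q <;> cases q' <;> simp only [longDiag, shortDiag, ne_eq, Sym2.eq_iff, Prod.mk.injEq] <;>
    omega

theorem longDiag_injective : Function.Injective fun r : Kind × Vertex => longDiag r.1 r.2 := by
  rintro ⟨q, i, j, k⟩ ⟨q', i', j', k'⟩ h
  cases q <;> cases q' <;> simp only [longDiag, Sym2.eq_iff, Prod.mk.injEq] at h <;>
    simp <;> omega

theorem shortDiag_injective : Function.Injective fun r : Kind × Vertex => shortDiag r.1 r.2 := by
  rintro ⟨q, i, j, k⟩ ⟨q', i', j', k'⟩ h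
  cases q <;> cases q' <;> simp only [shortDiag, Sym2.eq_iff, Prod.mk.injEq] at h <;>
    simp <;> omega

theorem longDiag_not_isDiag (q : Kind) (v : Vertex) : ¬ (longDiag q v).IsDiag := by
  obtain ⟨i, j, k⟩ := v
  cases q <;> simp [longDiag]

theorem shortDiag_not_isDiag (q : Kind) (v : Vertex) : ¬ (shortDiag q v).IsDiag := by
  obtain ⟨i, j, k⟩ := v
  cases q <;>
  · simp [shortDiag]
    omega

theorem unit_nonneg (q : Kind) : 0 ≤ unit q := by
  cases q <;> simp [unit, Prod.le_def]

theorem unit_ne_zero (q : Kind) : unit q ≠ 0 := by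
  cases q <;> simp [unit]

theorem unit_add_unit_add_unit (q : Kind) : unit q + unit q.next + unit q.prev = (1, 1, 1) := by
  cases q <;> simp [unit, Kind.next, Kind.prev]

theorem height_unit (q : Kind) : height (unit q) = 1 := by
  cases q <;> simp [unit, height]

theorem height_add (u v : Vertex) : height (u + v) = height u + height v := by
  simp only [height, Prod.fst_add, Prod.snd_add]; ring

theorem height_sub (u v : Vertex) : height (u - v) = height u - height v := by
  simp only [height, Prod.fst_sub, Prod.snd_sub]; ring

/-! ### Rhombi of a set of initial conditions -/

/-- The rhombi contained in `boundary L`, see `rhombus_subset_boundary_iff`. -/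
def rhombi (L : Set Vertex) : Set (Kind × Vertex) :=
  {r | r.2 ∈ L ∧ r.2 + unit r.1 ∉ L}

theorem mem_rhombi {L : Set Vertex} {q : Kind} {v : Vertex} :
    (q, v) ∈ rhombi L ↔ v ∈ L ∧ v + unit q ∉ L := Iff.rfl

/-- Every point of the rhombus lies below its top `v`, and adding `(1, 1, 1)` to any of them gives a
point above `v + unit q`, with equality at the lowest one. So lowerness reduces the condition to
these two points. -/
theorem rhombus_subset_boundary_iff {L : Set Vertex} (hL : IsLowerSystem L) (q : Kind)
    (v : Vertex) : rhombus q v ⊆ boundary L ↔ (q, v) ∈ rhombi L := by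
  obtain ⟨i, j, k⟩ := v
  constructor
  · intro h
    refine ⟨(h (a := (i, j, k)) (by cases q <;> simp [rhombus])).1, ?_⟩
    cases q
    · simpa [unit] using (h (a := (i, j - 1, k - 1)) (by simp [rhombus])).2
    · simpa [unit] using (h (a := (i - 1, j, k - 1)) (by simp [rhombus])).2
    · simpa [unit] using (h (a := (i - 1, j - 1, k)) (by simp [rhombus])).2
  · rintro ⟨h1, h2⟩ ⟨a, b, c⟩ hu
    have key : (a, b, c) ≤ (i, j, k) ∧ (i, j, k) + unit q ≤ (a, b, c) + (1, 1, 1) := by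
      cases q <;>
      · simp only [rhombus, Set.mem_insert_iff, Set.mem_singleton_iff, Prod.mk.injEq] at hu
        simp only [unit, Prod.mk_add_mk, Prod.mk_le_mk]
        omega
    exact ⟨hL.lower _ h1 _ key.1, fun h => h2 (hL.lower _ h _ key.2)⟩

theorem height_le_of_mem_rhombus {q : Kind} {v u : Vertex} (h : u ∈ rhombus q v) :
    height u ≤ height v := by
  obtain ⟨i, j, k⟩ := v
  obtain ⟨a, b, c⟩ := u
  cases q <;>
  · simp only [rhombus, Set.mem_insert_iff, Set.mem_singleton_iff, Prod.mk.injEq] at h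
    simp only [height]
    omega

theorem finite_height_ge (N : ℤ) : {v : Vertex | v ≤ 0 ∧ N ≤ height v}.Finite := by
  refine (Set.finite_Icc ((N, N, N) : Vertex) 0).subset ?_
  rintro ⟨i, j, k⟩ ⟨h0, h⟩
  simp only [Prod.le_def, Prod.fst_zero, Prod.snd_zero, height, Set.mem_Icc] at *
  omega

/-! ### Configurations -/

/-- The diagonals selected by the set `A` of rhombi carrying their long diagonal. -/
def configEdges (R : Set (Kind × Vertex)) (A : Set (Kind × Vertex)) : Set (Sym2 Vertex) :=
  {d | ∃ r ∈ R, (r ∈ A ∧ d = longDiag r.1 r.2) ∨ (r ∉ A ∧ d = shortDiag r.1 r.2)}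

/-- The graph with edges `configEdges (rhombi L) A`. -/
def configGraph (L : Set Vertex) (A : Set (Kind × Vertex)) : SimpleGraph Vertex :=
  SimpleGraph.fromEdgeSet (configEdges (rhombi L) A)

/-- The connectivity condition of groves. -/
def IsConnecting (I : Set Vertex) (G : SimpleGraph Vertex) : Prop :=
  ∀ᶠ N : ℤ in atTop,
    (∀ v ∈ I, ∃! S, S ∈ anchors N ∧ ∀ u ∈ S, G.Reachable v u) ∧
    (∀ S ∈ anchors N, ∃ v ∈ I, ∀ u ∈ S, G.Reachable v u)

/-- The sets of rhombi that carry the long edges of a grove. -/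
def configs (L : Set Vertex) : Set (Finset (Kind × Vertex)) :=
  {A | ↑A ⊆ rhombi L ∧ IsConnecting (boundary L) (configGraph L A)}

theorem edgeSet_configGraph (L : Set Vertex) (A : Set (Kind × Vertex)) :
    (configGraph L A).edgeSet = configEdges (rhombi L) A := by
  rw [configGraph, SimpleGraph.edgeSet_fromEdgeSet, sdiff_eq_left, Set.disjoint_left]
  rintro d ⟨r, -, ⟨-, rfl⟩ | ⟨-, rfl⟩⟩
  · exact longDiag_not_isDiag _ _
  · exact shortDiag_not_isDiag _ _

theorem longDiag_mem_configEdges {R A : Set (Kind × Vertex)} {q : Kind} {v : Vertex} :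
    longDiag q v ∈ configEdges R A ↔ (q, v) ∈ R ∧ (q, v) ∈ A := by
  constructor
  · rintro ⟨r, hr, ⟨h, e⟩ | ⟨-, e⟩⟩
    · obtain rfl : (q, v) = r := longDiag_injective e
      exact ⟨hr, h⟩
    · exact absurd e (longDiag_ne_shortDiag _ _ _ _)
  · rintro ⟨h, h'⟩
    exact ⟨_, h, .inl ⟨h', rfl⟩⟩

theorem shortDiag_mem_configEdges {R A : Set (Kind × Vertex)} {q : Kind} {v : Vertex} :
    shortDiag q v ∈ configEdges R A ↔ (q, v) ∈ R ∧ (q, v) ∉ A := by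
  constructor
  · rintro ⟨r, hr, ⟨-, e⟩ | ⟨h, e⟩⟩
    · exact absurd e.symm (longDiag_ne_shortDiag _ _ _ _)
    · obtain rfl : (q, v) = r := shortDiag_injective e
      exact ⟨hr, h⟩
  · rintro ⟨h, h'⟩
    exact ⟨_, h, .inr ⟨h', rfl⟩⟩

theorem isGrove_configGraph {L : Set Vertex} (hL : IsLowerSystem L) {A : Finset (Kind × Vertex)}
    (hA : A ∈ configs L) : IsGrove (boundary L) (configGraph L A) := by
  refine ⟨?_, ?_, ?_, hA.2⟩
  · refine SimpleGraph.fromEdgeSet_mono ?_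
    rintro d ⟨r, hr, h⟩
    refine ⟨r.1, r.2, hL.nonpos _ hr.1, (rhombus_subset_boundary_iff hL r.1 r.2).2 hr, ?_⟩
    exact h.imp And.right And.right
  · intro q v _ h
    rw [rhombus_subset_boundary_iff hL] at h
    rw [edgeSet_configGraph, longDiag_mem_configEdges, shortDiag_mem_configEdges]
    by_cases h' : (q, v) ∈ (A : Set (Kind × Vertex))
    · exact .inl ⟨⟨h, h'⟩, fun h'' => h''.2 h'⟩
    · exact .inr ⟨⟨h, h'⟩, fun h'' => h' h''.2⟩
  · obtain ⟨N, hN⟩ : ∃ N : ℤ, ∀ r ∈ A, -height r.2 ≤ N := by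
      obtain ⟨N, hN⟩ := (A.finite_toSet.image fun r => -height r.2).bddAbove
      exact ⟨N, fun r hr => hN (Set.mem_image_of_mem _ hr)⟩
    refine ⟨N, fun q v _ h hlow => ?_⟩
    rw [rhombus_subset_boundary_iff hL] at h
    rw [edgeSet_configGraph, shortDiag_mem_configEdges]
    refine ⟨h, fun hmem => ?_⟩
    have h1 := hN (q, v) hmem
    have h2 := hlow v (by obtain ⟨i, j, k⟩ := v; cases q <;> simp [rhombus])
    simp only at h1
    omega

theorem exists_config_of_isGrove {L : Set Vertex} (hL : IsLowerSystem L) {G : SimpleGraph Vertex}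
    (hG : IsGrove (boundary L) G) : ∃ A ∈ configs L, configGraph L A = G := by
  classical
  obtain ⟨N, hN⟩ := hG.compact
  -- As `v` is a highest point of `r_q(v)`, the compactness bound leaves only rhombi with `-N ≤
  -- height v` for long diagonals, and the octant has finitely many such `v`.
  have hfin : {r : Kind × Vertex | r ∈ rhombi L ∧ longDiag r.1 r.2 ∈ G.edgeSet}.Finite := by
    refine (Set.finite_univ.prod (finite_height_ge (-N))).subset ?_
    rintro ⟨q, v⟩ ⟨hr, h⟩
    refine ⟨trivial, hL.nonpos _ hr.1, ?_⟩
    by_contra hlt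
    have hsub := (rhombus_subset_boundary_iff hL q v).2 hr
    have hs := hN q v (hL.nonpos _ hr.1) hsub
      fun u hu => (height_le_of_mem_rhombus hu).trans_lt (not_le.1 hlt)
    rcases hG.complementary q v (hL.nonpos _ hr.1) hsub with h' | h'
    · exact h'.2 hs
    · exact h'.2 h
  have hgraph : configGraph L hfin.toFinset = G := by
    rw [← SimpleGraph.edgeSet_inj, edgeSet_configGraph]
    ext d
    constructor
    · rintro ⟨⟨q, v⟩, hr, ⟨h, rfl⟩ | ⟨h, rfl⟩⟩
      · exact (hfin.mem_toFinset.1 h).2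
      · have hsub := (rhombus_subset_boundary_iff hL q v).2 hr
        rcases hG.complementary q v (hL.nonpos _ hr.1) hsub with h' | h'
        · exact absurd (hfin.mem_toFinset.2 ⟨hr, h'.1⟩) h
        · exact h'.1
    · intro hd
      have hd' := SimpleGraph.edgeSet_mono hG.le_ambient hd
      rw [ambientGraph, SimpleGraph.edgeSet_fromEdgeSet] at hd'
      obtain ⟨⟨q, v, hv, hsub, rfl | rfl⟩, -⟩ := hd'
      · have hr := (rhombus_subset_boundary_iff hL q v).1 hsub
        exact longDiag_mem_configEdges.2 ⟨hr, hfin.mem_toFinset.2 ⟨hr, hd⟩⟩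
      · have hr := (rhombus_subset_boundary_iff hL q v).1 hsub
        refine shortDiag_mem_configEdges.2 ⟨hr, fun h => ?_⟩
        rcases hG.complementary q v hv hsub with h' | h'
        · exact h'.2 hd
        · exact h'.2 (hfin.mem_toFinset.1 h).2
  refine ⟨hfin.toFinset, ⟨fun r hr => (hfin.mem_toFinset.1 hr).1, ?_⟩, hgraph⟩
  rw [hgraph]
  exact hG.connectivity

theorem configGraph_injOn (L : Set Vertex) :
    Set.InjOn (fun A : Finset (Kind × Vertex) => configGraph L A) (configs L) := by
  have key : ∀ A ∈ configs L, ∀ r : Kind × Vertex,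
      r ∈ A ↔ longDiag r.1 r.2 ∈ (configGraph L A).edgeSet := by
    rintro A hA ⟨q, v⟩
    rw [edgeSet_configGraph, longDiag_mem_configEdges]
    exact ⟨fun h => ⟨hA.1 h, h⟩, fun h => h.2⟩
  intro A hA B hB h
  ext r
  rw [key A hA, key B hB]
  simp only at h
  rw [h]

theorem groves_boundary {L : Set Vertex} (hL : IsLowerSystem L) :
    groves (boundary L) = (fun A : Finset (Kind × Vertex) => configGraph L A) '' configs L := by
  ext G
  constructor
  · exact exists_config_of_isGrove hL
  · rintro ⟨A, hA, rfl⟩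
    exact isGrove_configGraph hL hA

/-- The product of the conductances of the long diagonals of the rhombi in `A`. -/
def configWeight (C : Sym2 Vertex → ℂ) (A : Finset (Kind × Vertex)) : ℂ :=
  ∏ r ∈ A, long C r.1 r.2

theorem weight_configGraph (C : Sym2 Vertex → ℂ) {L : Set Vertex} (hL : IsLowerSystem L)
    {A : Finset (Kind × Vertex)} (hA : A ∈ configs L) :
    weight C (configGraph L A) = configWeight C A := by
  have h : longDiagonals ∩ (configGraph L A).edgeSet =
      (fun r : Kind × Vertex => longDiag r.1 r.2) '' A := by
    rw [edgeSet_configGraph]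
    ext d
    constructor
    · rintro ⟨⟨q, v, -, rfl⟩, h⟩
      exact ⟨(q, v), (longDiag_mem_configEdges.1 h).2, rfl⟩
    · rintro ⟨⟨q, v⟩, h, rfl⟩
      exact ⟨⟨q, v, hL.nonpos _ (hA.1 h).1, rfl⟩, longDiag_mem_configEdges.2 ⟨hA.1 h, h⟩⟩
  rw [weight, h, finprod_mem_image longDiag_injective.injOn, finprod_mem_coe_finset]
  rfl

theorem partitionFunction_boundary (C : Sym2 Vertex → ℂ) {L : Set Vertex} (hL : IsLowerSystem L)
    (hfin : (configs L).Finite) :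
    partitionFunction C (boundary L) = ∑ A ∈ hfin.toFinset, configWeight C A := by
  rw [partitionFunction, groves_boundary hL, finsum_mem_image (configGraph_injOn L),
    finsum_mem_eq_finite_toFinset_sum _ hfin]
  exact Finset.sum_congr rfl fun A hA => weight_configGraph C hL (hfin.mem_toFinset.1 hA)

open scoped Classical in
theorem longProbOn_boundary (C : Sym2 Vertex → ℂ) {L : Set Vertex} (hL : IsLowerSystem L)
    (hfin : (configs L).Finite) (q : Kind) (v : Vertex) :
    longProbOn C (boundary L) q v =
      (∑ A ∈ hfin.toFinset, if (q, v) ∈ A then configWeight C A else 0) /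
        partitionFunction C (boundary L) := by
  have h : {G | G ∈ groves (boundary L) ∧ longDiag q v ∈ G.edgeSet} =
      (fun A : Finset (Kind × Vertex) => configGraph L A) ''
        {A | A ∈ configs L ∧ (q, v) ∈ A} := by
    rw [groves_boundary hL]
    ext G
    constructor
    · rintro ⟨⟨A, hA, rfl⟩, h⟩
      simp only [edgeSet_configGraph] at h
      exact ⟨A, ⟨hA, (longDiag_mem_configEdges.1 h).2⟩, rfl⟩
    · rintro ⟨A, ⟨hA, h⟩, rfl⟩
      refine ⟨⟨A, hA, rfl⟩, ?_⟩
      simp only [edgeSet_configGraph]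
      exact longDiag_mem_configEdges.2 ⟨hA.1 h, h⟩
  have hfin' : {A | A ∈ configs L ∧ (q, v) ∈ A}.Finite := hfin.subset fun A h => h.1
  rw [longProbOn, h, finsum_mem_image ((configGraph_injOn L).mono fun A h => h.1),
    finsum_mem_eq_finite_toFinset_sum _ hfin', ← Finset.sum_filter, Finset.sum_div]
  refine Finset.sum_congr ?_ fun A hA => ?_
  · ext A; simp
  · rw [groveProb, weight_configGraph C hL (hfin.mem_toFinset.1 (Finset.mem_filter.1 hA).1)]

/-! ### Reachability and star-triangle exchange -/

section Gadget

variable {V : Type*}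

theorem reachable_of_mem_edges {E : Set (Sym2 V)} {s t : V} (h : s(s, t) ∈ E) :
    (SimpleGraph.fromEdgeSet E).Reachable s t := by
  by_cases hst : s = t
  · rw [hst]
  · exact SimpleGraph.Adj.reachable ((SimpleGraph.fromEdgeSet_adj E).2 ⟨h, hst⟩)

theorem reachable_map_of_edges {E : Set (Sym2 V)} {G : SimpleGraph V} (φ : V → V)
    (h : ∀ d ∈ E, ∃ s t, d = s(s, t) ∧ G.Reachable (φ s) (φ t)) {x y : V}
    (hxy : (SimpleGraph.fromEdgeSet E).Reachable x y) : G.Reachable (φ x) (φ y) := by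
  obtain ⟨p⟩ := hxy
  induction p with
  | nil => rfl
  | cons hadj _ ih =>
    refine SimpleGraph.Reachable.trans ?_ ih
    obtain ⟨s, t, e, hr⟩ := h _ ((SimpleGraph.fromEdgeSet_adj E).1 hadj).1
    rcases Sym2.eq_iff.1 e with ⟨rfl, rfl⟩ | ⟨rfl, rfl⟩
    · exact hr
    · exact hr.symm

/-- A choice, for each kind `q`, between the side of the triangle `P` opposite to `P q` (if `q ∈ S`)
and the ray from the centre `c` to `Q q`. -/
def gadget (c : V) (P Q : Kind → V) (S : Finset Kind) : Set (Sym2 V) :=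
  {d | ∃ q, (q ∈ S ∧ d = s(P q.next, P q.prev)) ∨ (q ∉ S ∧ d = s(c, Q q))}

theorem side_mem_gadget {c : V} {P Q : Kind → V} {S : Finset Kind} {q : Kind} (h : q ∈ S) :
    s(P q.next, P q.prev) ∈ gadget c P Q S := ⟨q, .inl ⟨h, rfl⟩⟩

theorem ray_mem_gadget {c : V} {P Q : Kind → V} {S : Finset Kind} {q : Kind} (h : q ∉ S) :
    s(c, Q q) ∈ gadget c P Q S := ⟨q, .inr ⟨h, rfl⟩⟩

variable {E : Set (Sym2 V)} {c c' : V} {P Q : Kind → V}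

/-- To transfer reachability it suffices to redirect the centre `c` to a point `z`. -/
theorem reachable_of_redirect {S : Finset Kind} {F : Set (Sym2 V)} (z : V) (hE : ∀ d ∈ E, c ∉ d)
    (hP : ∀ q, P q ≠ c) (hQ : ∀ q, Q q ≠ c) (hEF : E ⊆ F)
    (hside : ∀ q ∈ S, (SimpleGraph.fromEdgeSet F).Reachable (P q.next) (P q.prev))
    (hray : ∀ q ∉ S, (SimpleGraph.fromEdgeSet F).Reachable z (Q q)) {x y : V}
    (hx : x ≠ c) (hy : y ≠ c)
    (h : (SimpleGraph.fromEdgeSet (E ∪ gadget c P Q S)).Reachable x y) :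
    (SimpleGraph.fromEdgeSet F).Reachable x y := by
  classical
  have h' := reachable_map_of_edges (G := SimpleGraph.fromEdgeSet F) (Function.update id c z) ?_ h
  · simpa [Function.update_of_ne hx, Function.update_of_ne hy] using h'
  rintro d (hd | ⟨q, ⟨hq, rfl⟩ | ⟨hq, rfl⟩⟩)
  · induction d with
    | h s t =>
      have hs : s ≠ c := fun e => hE _ hd (e ▸ Sym2.mem_mk_left s t)
      have ht : t ≠ c := fun e => hE _ hd (e ▸ Sym2.mem_mk_right s t)
      refine ⟨s, t, rfl, ?_⟩
      simpa [Function.update_of_ne hs, Function.update_of_ne ht] using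
        reachable_of_mem_edges (hEF hd)
  · refine ⟨_, _, rfl, ?_⟩
    simpa [Function.update_of_ne (hP _)] using hside q hq
  · refine ⟨_, _, rfl, ?_⟩
    simpa [Function.update_of_ne (hQ _)] using hray q hq

/-- With one side and two rays, the rays form a path through the centre joining `Q q.next` to `Q
q.prev`, which serves as a side of the other triangle. The side of `P` becomes in turn a path
through the new centre. -/
theorem reachable_gadget_singleton (hE : ∀ d ∈ E, c ∉ d) (hP : ∀ q, P q ≠ c) (hQ : ∀ q, Q q ≠ c)
    (q : Kind) {x y : V} (hx : x ≠ c) (hy : y ≠ c)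
    (h : (SimpleGraph.fromEdgeSet (E ∪ gadget c P Q {q})).Reachable x y) :
    (SimpleGraph.fromEdgeSet (E ∪ gadget c' Q P {q})).Reachable x y := by
  refine reachable_of_redirect (Q q.next) hE hP hQ Set.subset_union_left ?_ ?_ hx hy h
  · intro r hr
    obtain rfl := Finset.mem_singleton.1 hr
    refine (reachable_of_mem_edges (s := c') (.inr (ray_mem_gadget ?_))).symm.trans
      (reachable_of_mem_edges (s := c') (.inr (ray_mem_gadget ?_)))
    · simpa using r.prev_ne
    · simpa using r.next_ne
  · intro r hr
    rcases q.eq_or r with rfl | rfl | rfl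
    · simp at hr
    · rfl
    · exact reachable_of_mem_edges (.inr (side_mem_gadget (by simp)))

/-- The full star joins all `Q r`. So do the two sides of the triangle `Q` that meet at `Q q`, and
the remaining ray of the new gadget is a pendant edge towards its centre. -/
theorem reachable_triangle_of_star (hE : ∀ d ∈ E, c ∉ d) (hP : ∀ q, P q ≠ c) (hQ : ∀ q, Q q ≠ c)
    (q : Kind) {x y : V} (hx : x ≠ c) (hy : y ≠ c)
    (h : (SimpleGraph.fromEdgeSet (E ∪ gadget c P Q ∅)).Reachable x y) :
    (SimpleGraph.fromEdgeSet (E ∪ gadget c' Q P {q}ᶜ)).Reachable x y := by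
  refine reachable_of_redirect (Q q) hE hP hQ Set.subset_union_left ?_ ?_ hx hy h
  · intro r hr
    simp at hr
  · intro r _
    rcases q.eq_or r with rfl | rfl | rfl
    · rfl
    · have := side_mem_gadget (c := c') (P := Q) (Q := P) (S := {q}ᶜ) (q := q.prev)
        (by simpa using q.prev_ne)
      rw [Kind.prev_next, Kind.prev_prev] at this
      exact reachable_of_mem_edges (.inr this)
    · have := side_mem_gadget (c := c') (P := Q) (Q := P) (S := {q}ᶜ) (q := q.next)
        (by simpa using q.next_ne)
      rw [Kind.next_prev, Kind.next_next] at this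
      exact (reachable_of_mem_edges (.inr this)).symm

theorem reachable_star_of_triangle (hE : ∀ d ∈ E, c ∉ d) (hP : ∀ q, P q ≠ c) (hQ : ∀ q, Q q ≠ c)
    (q : Kind) {x y : V} (hx : x ≠ c) (hy : y ≠ c)
    (h : (SimpleGraph.fromEdgeSet (E ∪ gadget c P Q {q}ᶜ)).Reachable x y) :
    (SimpleGraph.fromEdgeSet (E ∪ gadget c' Q P ∅)).Reachable x y := by
  refine reachable_of_redirect (Q q) hE hP hQ Set.subset_union_left ?_ ?_ hx hy h
  · intro r _
    exact (reachable_of_mem_edges (s := c') (.inr (ray_mem_gadget (by simp)))).symm.trans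
      (reachable_of_mem_edges (s := c') (.inr (ray_mem_gadget (by simp))))
  · intro r hr
    obtain rfl : r = q := by simpa using hr
    rfl

theorem eq_of_reachable_gadget_univ (hE : ∀ d ∈ E, c ∉ d) (hP : ∀ q, P q ≠ c) {x : V}
    (h : (SimpleGraph.fromEdgeSet (E ∪ gadget c P Q Finset.univ)).Reachable c x) : x = c := by
  obtain ⟨p⟩ := h
  cases p with
  | nil => rfl
  | cons hadj _ =>
    exfalso
    rcases ((SimpleGraph.fromEdgeSet_adj _).1 hadj).1 with hd | ⟨q, ⟨-, e⟩ | ⟨hq, -⟩⟩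
    · exact hE _ hd (Sym2.mem_mk_left _ _)
    · rcases Sym2.eq_iff.1 e with ⟨e, -⟩ | ⟨e, -⟩
      · exact hP _ e.symm
      · exact hP _ e.symm
    · exact hq (Finset.mem_univ q)

end Gadget

/-! ### The connectivity condition under an exchange of one point -/

theorem nonempty_of_mem_anchors {N : ℤ} {S : Set Vertex} (h : S ∈ anchors N) : S.Nonempty := by
  rcases h with (⟨p, q, -, -, -, rfl | rfl | rfl⟩ | ⟨p, -, rfl⟩) | ⟨q, -, rfl | rfl | rfl⟩ <;> simp

theorem height_lt_of_mem_anchors {N : ℤ} {S : Set Vertex} (h : S ∈ anchors N) {u : Vertex}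
    (hu : u ∈ S) : height u < -N := by
  obtain ⟨i, j, k⟩ := u
  rcases h with (⟨p, q, h1, h2, h3, rfl | rfl | rfl⟩ | ⟨p, h1, rfl⟩) | ⟨q, h1, rfl | rfl | rfl⟩ <;>
  · simp only [Set.mem_insert_iff, Set.mem_singleton_iff, Prod.mk.injEq] at hu
    simp only [height]
    omega

/-- Anchors recede to infinity with `N`, so a local change at finitely many vertices never touches
them once `N` is large. -/
theorem eventually_ne_of_mem_anchors (c : Vertex) :
    ∀ᶠ N : ℤ in atTop, ∀ S ∈ anchors N, ∀ u ∈ S, u ≠ c := by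
  filter_upwards [eventually_ge_atTop (-height c)] with N hN S hS u hu e
  have := height_lt_of_mem_anchors hS hu
  rw [e] at this
  omega

/-- For large `N` the anchors avoid both centres, so the condition at the points of `J` only
involves reachability that is unchanged. A centre joined to some point of `J` adds no component of
its own, which is why `ht` and `ht'` suffice to treat it. -/
theorem IsConnecting.exchange {J : Set Vertex} {c c' : Vertex} {G G' : SimpleGraph Vertex}
    (hG : ∀ x y, x ≠ c → x ≠ c' → y ≠ c → y ≠ c' → (G.Reachable x y ↔ G'.Reachable x y))
    (hJ : ∀ x ∈ J, x ≠ c ∧ x ≠ c') (ht : ∃ t ∈ J, G.Reachable c t)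
    (ht' : ∃ t ∈ J, G'.Reachable c' t) (h : IsConnecting (insert c J) G) :
    IsConnecting (insert c' J) G' := by
  filter_upwards [h, eventually_ne_of_mem_anchors c, eventually_ne_of_mem_anchors c']
    with N hN hc hc'
  have key : ∀ x ∈ J, ∀ S ∈ anchors N,
      ((∀ u ∈ S, G.Reachable x u) ↔ ∀ u ∈ S, G'.Reachable x u) := fun x hx S hS =>
    forall₂_congr fun u hu => hG x u (hJ x hx).1 (hJ x hx).2 (hc S hS u hu) (hc' S hS u hu)
  have key' : ∀ x ∈ J, ∀ S,
      (S ∈ anchors N ∧ ∀ u ∈ S, G.Reachable x u) ↔ (S ∈ anchors N ∧ ∀ u ∈ S, G'.Reachable x u) :=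
    fun x hx S => and_congr_right fun hS => key x hx S hS
  have main : ∀ x ∈ J, ∃! S, S ∈ anchors N ∧ ∀ u ∈ S, G'.Reachable x u := by
    intro x hx
    have := hN.1 x (.inr hx)
    simpa only [key' x hx] using this
  constructor
  · rintro x (rfl | hx)
    · obtain ⟨t, htJ, hr⟩ := ht'
      have e : ∀ u, G'.Reachable x u ↔ G'.Reachable t u := fun u =>
        ⟨fun h => hr.symm.trans h, fun h => hr.trans h⟩
      simpa only [e] using main t htJ
    · exact main x hx
  · intro S hS
    obtain ⟨x, rfl | hx, hr⟩ := hN.2 S hS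
    · obtain ⟨t, htJ, hxt⟩ := ht
      exact ⟨t, .inr htJ, (key t htJ S hS).1 fun u hu => hxt.symm.trans (hr u hu)⟩
    · exact ⟨x, .inr hx, (key x hx S hS).1 hr⟩

section Exchange

variable {E : Set (Sym2 Vertex)} {J : Set Vertex} {c c' : Vertex} {P Q : Kind → Vertex}

/-- Three long diagonals would isolate the centre, whose component would then contain no anchor for
large `N`. -/
theorem not_isConnecting_gadget_univ (hE : ∀ d ∈ E, c ∉ d) (hP : ∀ q, P q ≠ c) :
    ¬ IsConnecting (insert c J) (SimpleGraph.fromEdgeSet (E ∪ gadget c P Q Finset.univ)) := by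
  intro h
  obtain ⟨N, hN, hne⟩ := (h.and (eventually_ne_of_mem_anchors c)).exists
  obtain ⟨S, ⟨hS, hr⟩, -⟩ := hN.1 c (Set.mem_insert _ _)
  obtain ⟨u, hu⟩ := nonempty_of_mem_anchors hS
  exact hne S hS u hu (eq_of_reachable_gadget_univ hE hP (hr u hu))

theorem exists_reachable_gadget (hQJ : ∀ q, Q q ∈ J) {S : Finset Kind} {q : Kind} (hq : q ∉ S) :
    ∃ t ∈ J, (SimpleGraph.fromEdgeSet (E ∪ gadget c P Q S)).Reachable c t :=
  ⟨Q q, hQJ q, reachable_of_mem_edges (.inr (ray_mem_gadget hq))⟩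

variable (hE : ∀ d ∈ E, c ∉ d) (hE' : ∀ d ∈ E, c' ∉ d) (hJ : ∀ x ∈ J, x ≠ c ∧ x ≠ c')
  (hPJ : ∀ q, P q ∈ J) (hQJ : ∀ q, Q q ∈ J)
include hE hE' hJ hPJ hQJ

theorem isConnecting_gadget_singleton (q : Kind) :
    IsConnecting (insert c J) (SimpleGraph.fromEdgeSet (E ∪ gadget c P Q {q})) ↔
      IsConnecting (insert c' J) (SimpleGraph.fromEdgeSet (E ∪ gadget c' Q P {q})) := by
  have hq : q.next ∉ ({q} : Finset Kind) := by simpa using q.next_ne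
  have h : ∀ x y, x ≠ c → x ≠ c' → y ≠ c → y ≠ c' →
      ((SimpleGraph.fromEdgeSet (E ∪ gadget c P Q {q})).Reachable x y ↔
        (SimpleGraph.fromEdgeSet (E ∪ gadget c' Q P {q})).Reachable x y) := by
    intro x y hx hx' hy hy'
    exact ⟨reachable_gadget_singleton hE (fun q => (hJ _ (hPJ q)).1) (fun q => (hJ _ (hQJ q)).1)
      q hx hy, reachable_gadget_singleton hE' (fun q => (hJ _ (hQJ q)).2)
      (fun q => (hJ _ (hPJ q)).2) q hx' hy'⟩
  exact ⟨IsConnecting.exchange h hJ (exists_reachable_gadget hQJ hq)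
      (exists_reachable_gadget hPJ hq),
    IsConnecting.exchange (fun x y h1 h2 h3 h4 => (h x y h2 h1 h4 h3).symm)
      (fun x hx => (hJ x hx).symm) (exists_reachable_gadget hPJ hq)
      (exists_reachable_gadget hQJ hq)⟩

theorem isConnecting_gadget_empty (q : Kind) :
    IsConnecting (insert c J) (SimpleGraph.fromEdgeSet (E ∪ gadget c P Q ∅)) ↔
      IsConnecting (insert c' J) (SimpleGraph.fromEdgeSet (E ∪ gadget c' Q P {q}ᶜ)) := by
  have hq : q ∉ ({q}ᶜ : Finset Kind) := by simp
  have h : ∀ x y, x ≠ c → x ≠ c' → y ≠ c → y ≠ c' →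
      ((SimpleGraph.fromEdgeSet (E ∪ gadget c P Q ∅)).Reachable x y ↔
        (SimpleGraph.fromEdgeSet (E ∪ gadget c' Q P {q}ᶜ)).Reachable x y) := by
    intro x y hx hx' hy hy'
    exact ⟨reachable_triangle_of_star hE (fun q => (hJ _ (hPJ q)).1) (fun q => (hJ _ (hQJ q)).1)
      q hx hy, reachable_star_of_triangle hE' (fun q => (hJ _ (hQJ q)).2)
      (fun q => (hJ _ (hPJ q)).2) q hx' hy'⟩
  exact ⟨IsConnecting.exchange h hJ (exists_reachable_gadget hQJ (Finset.notMem_empty q))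
      (exists_reachable_gadget hPJ hq),
    IsConnecting.exchange (fun x y h1 h2 h3 h4 => (h x y h2 h1 h4 h3).symm)
      (fun x hx => (hJ x hx).symm) (exists_reachable_gadget hPJ hq)
      (exists_reachable_gadget hQJ (Finset.notMem_empty q))⟩

end Exchange

/-! ### The cube move -/

theorem exists_add_unit_le {u x : Vertex} (h : u ≤ x) (hne : u ≠ x) : ∃ q, u + unit q ≤ x := by
  obtain ⟨i, j, k⟩ := u
  obtain ⟨i', j', k'⟩ := x
  simp only [Prod.mk_le_mk, ne_eq, Prod.mk.injEq] at h hne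
  by_cases h1 : i = i'
  · by_cases h2 : j = j'
    · exact ⟨.c, by simp only [unit, Prod.mk_add_mk, Prod.mk_le_mk]; omega⟩
    · exact ⟨.b, by simp only [unit, Prod.mk_add_mk, Prod.mk_le_mk]; omega⟩
  · exact ⟨.a, by simp only [unit, Prod.mk_add_mk, Prod.mk_le_mk]; omega⟩

/-- `v` is a maximal point of the lower system `L`. -/
structure IsTop (L : Set Vertex) (v : Vertex) : Prop where
  isLowerSystem : IsLowerSystem L
  mem : v ∈ L
  add_unit_notMem : ∀ q, v + unit q ∉ L

namespace IsTop

variable {L : Set Vertex} {v : Vertex}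

theorem notMem_of_add_unit_le (h : IsTop L v) {q : Kind} {x : Vertex} (hx : v + unit q ≤ x) :
    x ∉ L := fun hL => h.add_unit_notMem q (h.isLowerSystem.lower _ hL _ hx)

theorem sdiff (h : IsTop L v) : IsLowerSystem (L \ {v}) where
  nonpos x hx := h.isLowerSystem.nonpos x hx.1
  finite_compl := by
    refine (h.isLowerSystem.finite_compl.union (Set.finite_singleton v)).subset ?_
    rintro x ⟨h0, hx⟩
    by_cases hv : x = v
    · exact .inr hv
    · exact .inl ⟨h0, fun hL => hx ⟨hL, hv⟩⟩
  lower x hx u hu := by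
    refine ⟨h.isLowerSystem.lower x hx.1 u hu, ?_⟩
    rintro rfl
    obtain ⟨q, hq⟩ := exists_add_unit_le hu (fun e => hx.2 e.symm)
    exact h.notMem_of_add_unit_le hq hx.1

end IsTop

/-- The points common to `boundary L` and `boundary (L \ {v})`. -/
def commonPoints (L : Set Vertex) (v : Vertex) : Set Vertex := boundary L \ {v}

/-- The rhombi common to `rhombi L` and `rhombi (L \ {v})`. -/
def commonRhombi (L : Set Vertex) (v : Vertex) : Set (Kind × Vertex) := {r ∈ rhombi L | r.2 ≠ v}

/-- The three rhombi at the top of the cube below `v`. -/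
def topRhombus (v : Vertex) (q : Kind) : Kind × Vertex := (q, v)

/-- The three rhombi at the bottom of the cube below `v`. -/
def bottomRhombus (v : Vertex) (q : Kind) : Kind × Vertex := (q, v - unit q)

theorem topRhombus_injective (v : Vertex) : Function.Injective (topRhombus v) :=
  fun _ _ h => congrArg Prod.fst h

theorem bottomRhombus_injective (v : Vertex) : Function.Injective (bottomRhombus v) :=
  fun _ _ h => congrArg Prod.fst h

theorem sub_one_eq (v : Vertex) (q : Kind) :
    v - (1, 1, 1) = v - unit q - unit q.next - unit q.prev := by
  rw [← unit_add_unit_add_unit q]; abel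

theorem sub_one_add_unit (v : Vertex) (q : Kind) :
    v - (1, 1, 1) + unit q = v - unit q.next - unit q.prev := by
  rw [sub_one_eq v q]; abel

theorem longDiag_topRhombus (v : Vertex) (q : Kind) :
    longDiag (topRhombus v q).1 (topRhombus v q).2 = s(v - unit q.next, v - unit q.prev) :=
  longDiag_eq q v

theorem shortDiag_topRhombus (v : Vertex) (q : Kind) :
    shortDiag (topRhombus v q).1 (topRhombus v q).2 = s(v, v - (1, 1, 1) + unit q) := by
  rw [sub_one_add_unit]; exact shortDiag_eq q v

theorem longDiag_bottomRhombus (v : Vertex) (q : Kind) :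
    longDiag (bottomRhombus v q).1 (bottomRhombus v q).2 =
      s(v - (1, 1, 1) + unit q.next, v - (1, 1, 1) + unit q.prev) := by
  rw [sub_one_add_unit, sub_one_add_unit, Sym2.eq_swap, Kind.next_next, Kind.next_prev,
    Kind.prev_prev, Kind.prev_next, sub_right_comm]
  refine (longDiag_eq q _).trans (Sym2.eq_iff.2 (.inl ?_))
  constructor <;> simp only [bottomRhombus] <;> abel

theorem shortDiag_bottomRhombus (v : Vertex) (q : Kind) :
    shortDiag (bottomRhombus v q).1 (bottomRhombus v q).2 = s(v - (1, 1, 1), v - unit q) := by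
  rw [Sym2.eq_swap, sub_one_eq v q]; exact shortDiag_eq q _

namespace IsTop

variable {L : Set Vertex} {v : Vertex}

theorem boundary_eq (h : IsTop L v) : boundary L = insert v (commonPoints L v) := by
  rw [commonPoints, Set.insert_sdiff_singleton, Set.insert_eq_of_mem]
  exact ⟨h.mem, h.notMem_of_add_unit_le (q := .a) (by simp [unit, Prod.le_def])⟩

theorem sub_one_notMem_boundary (h : IsTop L v) : v - (1, 1, 1) ∉ boundary L := fun h' =>
  h'.2 (by rw [sub_add_cancel]; exact h.mem)

theorem boundary_sdiff_eq (h : IsTop L v) :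
    boundary (L \ {v}) = insert (v - (1, 1, 1)) (commonPoints L v) := by
  ext x
  constructor
  · rintro ⟨⟨h1, h2⟩, h3⟩
    by_cases e : x = v - (1, 1, 1)
    · exact .inl e
    · refine .inr ⟨⟨h1, fun h4 => h3 ⟨h4, fun h5 => e ?_⟩⟩, h2⟩
      rw [← Set.mem_singleton_iff.1 h5, add_sub_cancel_right]
  · rintro (rfl | ⟨⟨h1, h2⟩, h3⟩)
    · refine ⟨⟨h.isLowerSystem.lower _ h.mem _ ?_, ?_⟩, ?_⟩
      · simp [Prod.le_def]
      · simp [Prod.ext_iff]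
      · simp
    · exact ⟨⟨h1, h3⟩, fun h4 => h2 h4.1⟩

theorem commonPoints_ne (h : IsTop L v) {x : Vertex} (hx : x ∈ commonPoints L v) :
    x ≠ v ∧ x ≠ v - (1, 1, 1) :=
  ⟨hx.2, fun e => h.sub_one_notMem_boundary (e ▸ hx.1)⟩

theorem sub_unit_mem (h : IsTop L v) (q : Kind) : v - unit q ∈ commonPoints L v := by
  refine ⟨⟨h.isLowerSystem.lower _ h.mem _ (by simpa using unit_nonneg q), ?_⟩, ?_⟩
  · refine h.notMem_of_add_unit_le (q := q.next) ?_
    rw [← unit_add_unit_add_unit q]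
    have : v - unit q + (unit q + unit q.next + unit q.prev) = v + unit q.next + unit q.prev := by
      abel
    rw [this]
    simpa using unit_nonneg q.prev
  · simpa using unit_ne_zero q

theorem sub_one_add_unit_mem (h : IsTop L v) (q : Kind) :
    v - (1, 1, 1) + unit q ∈ commonPoints L v := by
  refine ⟨⟨h.isLowerSystem.lower _ h.mem _ ?_, ?_⟩, ?_⟩
  · rw [sub_one_add_unit, sub_sub]
    simpa using add_nonneg (unit_nonneg q.next) (unit_nonneg q.prev)
  · have : v - (1, 1, 1) + unit q + (1, 1, 1) = v + unit q := by abel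
    rw [this]
    exact h.add_unit_notMem q
  · cases q <;> simp [unit, Prod.ext_iff]

theorem rhombi_eq (h : IsTop L v) :
    rhombi L = commonRhombi L v ∪ Set.range (topRhombus v) := by
  ext ⟨q, x⟩
  constructor
  · intro hx
    by_cases e : x = v
    · exact .inr ⟨q, by rw [e]; rfl⟩
    · exact .inl ⟨hx, e⟩
  · rintro (hx | ⟨r, e⟩)
    · exact hx.1
    · obtain ⟨rfl, rfl⟩ := Prod.mk.inj e
      exact ⟨h.mem, h.add_unit_notMem _⟩

theorem rhombi_sdiff_eq (h : IsTop L v) :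
    rhombi (L \ {v}) = commonRhombi L v ∪ Set.range (bottomRhombus v) := by
  ext ⟨q, x⟩
  constructor
  · rintro ⟨⟨h1, h2⟩, h3⟩
    by_cases e : x + unit q = v
    · exact .inr ⟨q, by rw [← e, bottomRhombus, add_sub_cancel_right]⟩
    · exact .inl ⟨⟨h1, fun h4 => h3 ⟨h4, e⟩⟩, h2⟩
  · rintro (⟨⟨h1, h2⟩, h3⟩ | ⟨r, e⟩)
    · exact ⟨⟨h1, h3⟩, fun h4 => h2 h4.1⟩
    · obtain ⟨rfl, rfl⟩ := Prod.mk.inj e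
      exact ⟨⟨(h.sub_unit_mem r).1.1, (h.sub_unit_mem r).2⟩, by simp⟩

theorem commonRhombi_ne_bottom (h : IsTop L v) {q : Kind} :
    bottomRhombus v q ∉ commonRhombi L v := fun hq => hq.1.2 (by simpa [bottomRhombus] using h.mem)

end IsTop

theorem topRhombus_notMem_commonRhombi (L : Set Vertex) (v : Vertex) (q : Kind) :
    topRhombus v q ∉ commonRhombi L v := fun h => h.2 rfl

theorem mem_rhombus_of_mem_longDiag {q : Kind} {v u : Vertex} (h : u ∈ longDiag q v) :
    u ∈ rhombus q v := by
  obtain ⟨i, j, k⟩ := v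
  cases q <;> simp only [longDiag, Sym2.mem_iff] at h <;> rcases h with rfl | rfl <;> simp [rhombus]

theorem mem_rhombus_of_mem_shortDiag {q : Kind} {v u : Vertex} (h : u ∈ shortDiag q v) :
    u ∈ rhombus q v := by
  obtain ⟨i, j, k⟩ := v
  cases q <;> simp only [shortDiag, Sym2.mem_iff] at h <;> rcases h with rfl | rfl <;>
    simp [rhombus]

/-- A common rhombus is contained in both boundaries, hence avoids `v` and `v - (1, 1, 1)`. This
makes the gadget the only part of the graph that meets the centre. -/
theorem IsTop.mem_commonPoints {L : Set Vertex} {v : Vertex} (h : IsTop L v)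
    {A : Set (Kind × Vertex)} {d : Sym2 Vertex} (hd : d ∈ configEdges (commonRhombi L v) A)
    {u : Vertex} (hu : u ∈ d) : u ∈ commonPoints L v := by
  obtain ⟨⟨q, x⟩, hr, hd⟩ := hd
  have hux : u ∈ rhombus q x := by
    rcases hd with ⟨-, rfl⟩ | ⟨-, rfl⟩
    · exact mem_rhombus_of_mem_longDiag hu
    · exact mem_rhombus_of_mem_shortDiag hu
  have h1 : u ∈ boundary L := (rhombus_subset_boundary_iff h.isLowerSystem q x).2 hr.1 hux
  have h2 : u ∈ boundary (L \ {v}) := (rhombus_subset_boundary_iff h.sdiff q x).2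
    (by rw [h.rhombi_sdiff_eq]; exact .inl hr) hux
  exact ⟨h1, h2.1.2⟩

/-- Adding to the common rhombi a family `T` amounts to adding a gadget to the edges. -/
theorem configEdges_union_eq {K R : Set (Kind × Vertex)} {T : Kind → Kind × Vertex} {c : Vertex}
    {P Q : Kind → Vertex} (hT : Function.Injective T) (hR : R = K ∪ Set.range T)
    (hK : ∀ q, T q ∉ K)
    (hlong : ∀ q, longDiag (T q).1 (T q).2 = s(P q.next, P q.prev))
    (hshort : ∀ q, shortDiag (T q).1 (T q).2 = s(c, Q q))
    {A : Finset (Kind × Vertex)} (hA : ↑A ⊆ K) (S : Finset Kind) :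
    configEdges R ↑(A ∪ S.image T) = configEdges K A ∪ gadget c P Q S := by
  have h1 : ∀ r ∈ K, (r ∈ (↑(A ∪ S.image T) : Set (Kind × Vertex)) ↔ r ∈ (A : Set _)) := by
    intro r hr
    simp only [Finset.coe_union, Finset.coe_image, Set.mem_union, or_iff_left_iff_imp]
    rintro ⟨q, -, rfl⟩
    exact absurd hr (hK q)
  have h2 : ∀ q, (T q ∈ (↑(A ∪ S.image T) : Set (Kind × Vertex)) ↔ q ∈ S) := by
    intro q
    simp only [Finset.coe_union, Finset.coe_image, Set.mem_union]
    constructor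
    · rintro (h | ⟨q', hq', e⟩)
      · exact absurd (hA h) (hK q)
      · rw [← hT e]; exact hq'
    · exact fun h => .inr ⟨q, h, rfl⟩
  ext d
  constructor
  · rintro ⟨r, hr, hd⟩
    rw [hR] at hr
    rcases hr with hr | ⟨q, rfl⟩
    · rw [h1 r hr] at hd
      exact .inl ⟨r, hr, hd⟩
    · rw [h2, hlong, hshort] at hd
      exact .inr ⟨q, hd⟩
  · rintro (⟨r, hr, hd⟩ | ⟨q, hd⟩)
    · rw [← h1 r hr] at hd
      exact ⟨r, hR ▸ .inl hr, hd⟩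
    · rw [← h2, ← hlong, ← hshort] at hd
      exact ⟨T q, hR ▸ .inr ⟨q, rfl⟩, hd⟩

namespace IsTop

variable {L : Set Vertex} {v : Vertex} {A : Finset (Kind × Vertex)}

theorem mem_configs_iff (h : IsTop L v) (hA : ↑A ⊆ commonRhombi L v) (S : Finset Kind) :
    A ∪ S.image (topRhombus v) ∈ configs L ↔
      IsConnecting (insert v (commonPoints L v)) (SimpleGraph.fromEdgeSet
        (configEdges (commonRhombi L v) A ∪
          gadget v (fun q => v - unit q) (fun q => v - (1, 1, 1) + unit q) S)) := by
  rw [← configEdges_union_eq (topRhombus_injective v) h.rhombi_eq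
    (topRhombus_notMem_commonRhombi L v) (longDiag_topRhombus v) (shortDiag_topRhombus v) hA S,
    ← h.boundary_eq]
  refine and_iff_right ?_
  rw [h.rhombi_eq, Finset.coe_union, Finset.coe_image]
  exact Set.union_subset_union hA (Set.image_subset_range _ _)

theorem mem_configs_sdiff_iff (h : IsTop L v) (hA : ↑A ⊆ commonRhombi L v) (S : Finset Kind) :
    A ∪ S.image (bottomRhombus v) ∈ configs (L \ {v}) ↔
      IsConnecting (insert (v - (1, 1, 1)) (commonPoints L v)) (SimpleGraph.fromEdgeSet
        (configEdges (commonRhombi L v) A ∪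
          gadget (v - (1, 1, 1)) (fun q => v - (1, 1, 1) + unit q) (fun q => v - unit q) S)) := by
  rw [← configEdges_union_eq (bottomRhombus_injective v) h.rhombi_sdiff_eq
    (fun _ => h.commonRhombi_ne_bottom) (longDiag_bottomRhombus v) (shortDiag_bottomRhombus v) hA S,
    ← h.boundary_sdiff_eq]
  refine and_iff_right ?_
  rw [h.rhombi_sdiff_eq, Finset.coe_union, Finset.coe_image]
  exact Set.union_subset_union hA (Set.image_subset_range _ _)

theorem notMem_edge (h : IsTop L v) : ∀ d ∈ configEdges (commonRhombi L v) A, v ∉ d :=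
  fun _ hd hv => (h.commonPoints_ne (h.mem_commonPoints hd hv)).1 rfl

theorem sub_one_notMem_edge (h : IsTop L v) :
    ∀ d ∈ configEdges (commonRhombi L v) A, v - (1, 1, 1) ∉ d :=
  fun _ hd hv => (h.commonPoints_ne (h.mem_commonPoints hd hv)).2 rfl

theorem univ_notMem_configs (h : IsTop L v) (hA : ↑A ⊆ commonRhombi L v) :
    A ∪ Finset.univ.image (topRhombus v) ∉ configs L := by
  rw [h.mem_configs_iff hA]
  exact not_isConnecting_gadget_univ h.notMem_edge
    fun q => (h.commonPoints_ne (h.sub_unit_mem q)).1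

theorem univ_notMem_configs_sdiff (h : IsTop L v) (hA : ↑A ⊆ commonRhombi L v) :
    A ∪ Finset.univ.image (bottomRhombus v) ∉ configs (L \ {v}) := by
  rw [h.mem_configs_sdiff_iff hA]
  exact not_isConnecting_gadget_univ h.sub_one_notMem_edge
    fun q => (h.commonPoints_ne (h.sub_one_add_unit_mem q)).2

theorem singleton_mem_configs_iff (h : IsTop L v) (hA : ↑A ⊆ commonRhombi L v) (q : Kind) :
    A ∪ ({q} : Finset Kind).image (bottomRhombus v) ∈ configs (L \ {v}) ↔
      A ∪ ({q} : Finset Kind).image (topRhombus v) ∈ configs L := by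
  rw [h.mem_configs_iff hA, h.mem_configs_sdiff_iff hA]
  exact isConnecting_gadget_singleton h.sub_one_notMem_edge h.notMem_edge
    (fun x hx => (h.commonPoints_ne hx).symm) h.sub_one_add_unit_mem h.sub_unit_mem q

/-- One star above corresponds to three pairs of sides below, one for each `q`. Summing the weights
of such triples is what produces `pairSum` and `delta`. -/
theorem compl_singleton_mem_configs_sdiff_iff (h : IsTop L v) (hA : ↑A ⊆ commonRhombi L v)
    (q : Kind) : A ∪ ({q}ᶜ : Finset Kind).image (bottomRhombus v) ∈ configs (L \ {v}) ↔
      A ∈ configs L := by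
  have := h.mem_configs_iff hA ∅
  rw [Finset.image_empty, Finset.union_empty] at this
  rw [this, h.mem_configs_sdiff_iff hA]
  exact (isConnecting_gadget_empty h.notMem_edge h.sub_one_notMem_edge
    (fun x hx => h.commonPoints_ne hx) h.sub_unit_mem h.sub_one_add_unit_mem q).symm

theorem compl_singleton_mem_configs_iff (h : IsTop L v) (hA : ↑A ⊆ commonRhombi L v)
    (q : Kind) : A ∪ ({q}ᶜ : Finset Kind).image (topRhombus v) ∈ configs L ↔
      A ∈ configs (L \ {v}) := by
  have := h.mem_configs_sdiff_iff hA ∅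
  rw [Finset.image_empty, Finset.union_empty] at this
  rw [this, h.mem_configs_iff hA]
  exact (isConnecting_gadget_empty h.sub_one_notMem_edge h.notMem_edge
    (fun x hx => (h.commonPoints_ne hx).symm) h.sub_one_add_unit_mem h.sub_unit_mem q).symm

end IsTop

/-! ### Sums over configurations -/

theorem finset_kind_cases (S : Finset Kind) :
    S = ∅ ∨ (∃ q, S = {q}) ∨ (∃ q, S = {q}ᶜ) ∨ S = Finset.univ := by
  revert S; decide

theorem sdiff_union_image_filter {α : Type*} [DecidableEq α] (T : Kind → α) (A : Finset α) :
    (A \ Finset.univ.image T) ∪ (Finset.univ.filter fun q => T q ∈ A).image T = A := by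
  ext x
  simp only [Finset.mem_union, Finset.mem_sdiff, Finset.mem_image, Finset.mem_filter,
    Finset.mem_univ, true_and, not_exists]
  constructor
  · rintro (⟨h, -⟩ | ⟨q, h, rfl⟩) <;> exact h
  · intro h
    by_cases hx : ∃ q, T q = x
    · obtain ⟨q, rfl⟩ := hx
      exact .inr ⟨q, h, rfl⟩
    · exact .inl ⟨h, fun q e => hx ⟨q, e⟩⟩

/-- A configuration is determined by its part outside the cube and by the set of kinds that are long
inside it. The family `𝒜` may contain parts that do not extend to `𝒱`; the indicator discards them.
-/
theorem sum_eq_sum_sum_union_image {α : Type*} [DecidableEq α] {T : Kind → α}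
    (hT : Function.Injective T) (𝒱 𝒜 : Finset (Finset α)) (h𝒜 : ∀ A ∈ 𝒜, ∀ q, T q ∉ A)
    (h : ∀ A ∈ 𝒱, A \ Finset.univ.image T ∈ 𝒜) (f : Finset α → ℂ) (g : Finset Kind → ℂ) :
    ∑ A ∈ 𝒱, f (A \ Finset.univ.image T) * g (Finset.univ.filter fun q => T q ∈ A) =
      ∑ A ∈ 𝒜, ∑ S : Finset Kind, if A ∪ S.image T ∈ 𝒱 then f A * g S else 0 := by
  rw [← Finset.sum_product', ← Finset.sum_filter]
  have h1 : ∀ A ∈ 𝒜, ∀ S : Finset Kind, (A ∪ S.image T) \ Finset.univ.image T = A := by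
    intro A hA S
    ext x
    simp only [Finset.mem_union, Finset.mem_sdiff, Finset.mem_image, Finset.mem_univ, true_and,
      not_exists]
    constructor
    · rintro ⟨hx | ⟨q, -, rfl⟩, h'⟩
      · exact hx
      · exact absurd rfl (h' q)
    · exact fun hx => ⟨.inl hx, fun q e => h𝒜 A hA q (e ▸ hx)⟩
  have h2 : ∀ A ∈ 𝒜, ∀ S : Finset Kind,
      (Finset.univ.filter fun q => T q ∈ A ∪ S.image T) = S := by
    intro A hA S
    ext q
    simp only [Finset.mem_filter, Finset.mem_univ, true_and, Finset.mem_union, Finset.mem_image,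
      h𝒜 A hA q, false_or, hT.eq_iff, exists_eq_right]
  symm
  refine Finset.sum_nbij' (fun p => p.1 ∪ p.2.image T)
    (fun A => (A \ Finset.univ.image T, Finset.univ.filter fun q => T q ∈ A)) ?_ ?_ ?_ ?_ ?_
  · exact fun p hp => (Finset.mem_filter.1 hp).2
  · intro A hA
    simp only [Finset.mem_filter, Finset.mem_product, Finset.mem_univ, and_true,
      sdiff_union_image_filter]
    exact ⟨h A hA, hA⟩
  · rintro ⟨A, S⟩ hp
    have hA := (Finset.mem_product.1 (Finset.mem_filter.1 hp).1).1
    exact Prod.ext (h1 A hA S) (h2 A hA S)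
  · exact fun A _ => sdiff_union_image_filter T A
  · rintro ⟨A, S⟩ hp
    have hA := (Finset.mem_product.1 (Finset.mem_filter.1 hp).1).1
    simp only [h1 A hA S, h2 A hA S]

namespace IsTop

variable {L : Set Vertex} {v : Vertex}

theorem sdiff_top_subset (h : IsTop L v) {A : Finset (Kind × Vertex)} (hA : A ∈ configs L) :
    (↑(A \ Finset.univ.image (topRhombus v)) : Set (Kind × Vertex)) ⊆ commonRhombi L v := by
  intro r hr
  simp only [Finset.coe_sdiff, Finset.coe_image, Finset.coe_univ, Set.image_univ] at hr
  have := hA.1 hr.1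
  rw [h.rhombi_eq] at this
  exact this.resolve_right hr.2

theorem sdiff_bottom_subset (h : IsTop L v) {A : Finset (Kind × Vertex)}
    (hA : A ∈ configs (L \ {v})) :
    (↑(A \ Finset.univ.image (bottomRhombus v)) : Set (Kind × Vertex)) ⊆ commonRhombi L v := by
  intro r hr
  simp only [Finset.coe_sdiff, Finset.coe_image, Finset.coe_univ, Set.image_univ] at hr
  have := hA.1 hr.1
  rw [h.rhombi_sdiff_eq] at this
  exact this.resolve_right hr.2

/-- Any outside part occurring after the move already occurs before it. This transfers finiteness
and lets both sums of `exists_sums` range over one index family. -/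
theorem exists_config_eq_sdiff (h : IsTop L v) {A : Finset (Kind × Vertex)}
    (hA : A ∈ configs (L \ {v})) : ∃ B ∈ configs L,
      A \ Finset.univ.image (bottomRhombus v) = B \ Finset.univ.image (topRhombus v) := by
  have hsub := h.sdiff_bottom_subset hA
  rw [← sdiff_union_image_filter (bottomRhombus v) A] at hA
  generalize A \ Finset.univ.image (bottomRhombus v) = A₀ at hA hsub ⊢
  generalize (Finset.univ.filter fun q => bottomRhombus v q ∈ A) = S at hA
  suffices ∃ S : Finset Kind, A₀ ∪ S.image (topRhombus v) ∈ configs L by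
    obtain ⟨S, hS⟩ := this
    refine ⟨_, hS, ?_⟩
    ext r
    simp only [Finset.mem_union, Finset.mem_sdiff, Finset.mem_image, Finset.mem_univ, true_and,
      not_exists]
    constructor
    · exact fun hr => ⟨.inl hr, fun q e =>
        topRhombus_notMem_commonRhombi L v q (e ▸ hsub (Finset.mem_coe.2 hr))⟩
    · rintro ⟨hr | ⟨q, -, e⟩, h'⟩
      · exact hr
      · exact absurd e (h' q)
  rcases finset_kind_cases S with rfl | ⟨q, rfl⟩ | ⟨q, rfl⟩ | rfl
  · rw [Finset.image_empty, Finset.union_empty] at hA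
    -- Any of the three pairs of sides would do.
    refine ⟨{Kind.a}ᶜ, ?_⟩
    rw [h.compl_singleton_mem_configs_iff hsub]
    exact hA
  · exact ⟨{q}, (h.singleton_mem_configs_iff hsub q).1 hA⟩
  · refine ⟨∅, ?_⟩
    rw [Finset.image_empty, Finset.union_empty]
    exact (h.compl_singleton_mem_configs_sdiff_iff hsub q).1 hA
  · exact absurd hA (h.univ_notMem_configs_sdiff hsub)

theorem finite_configs_sdiff (h : IsTop L v) (hfin : (configs L).Finite) :
    (configs (L \ {v})).Finite := by
  refine ((hfin.image fun B => B \ Finset.univ.image (topRhombus v)).prod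
    (Set.finite_univ (α := Finset Kind))).image
      (fun p => p.1 ∪ p.2.image (bottomRhombus v)) |>.subset fun A hA => ?_
  obtain ⟨B, hB, e⟩ := h.exists_config_eq_sdiff hA
  exact ⟨(A \ Finset.univ.image (bottomRhombus v), _), ⟨⟨B, hB, e.symm⟩, trivial⟩,
    sdiff_union_image_filter (bottomRhombus v) A⟩

/-- The effect of a cube move on sums over configurations. The sums `x`, `y q`, `t` run over the
configurations outside the cube that connect, respectively, the three lower neighbours of the top
only, two pairs, and the three upper neighbours only. -/
theorem exists_sums (h : IsTop L v) (hfin : (configs L).Finite)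
    (hfin' : (configs (L \ {v})).Finite) (f : Finset (Kind × Vertex) → ℂ) :
    ∃ (x t : ℂ) (y : Kind → ℂ), ∀ g : Finset Kind → ℂ,
      (∑ A ∈ hfin.toFinset, f (A \ Finset.univ.image (topRhombus v)) *
          g (Finset.univ.filter fun q => topRhombus v q ∈ A) =
        x * g ∅ + ∑ q, y q * g {q} + t * ∑ q, g {q}ᶜ) ∧
      (∑ A ∈ hfin'.toFinset, f (A \ Finset.univ.image (bottomRhombus v)) *
          g (Finset.univ.filter fun q => bottomRhombus v q ∈ A) =
        x * ∑ q, g {q}ᶜ + ∑ q, y q * g {q} + t * g ∅) := by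
  classical
  set 𝒜 : Finset (Finset (Kind × Vertex)) :=
    hfin.toFinset.image fun B => B \ Finset.univ.image (topRhombus v) with h𝒜
  have hsub : ∀ A ∈ 𝒜, (A : Set (Kind × Vertex)) ⊆ commonRhombi L v := by
    intro A hA
    obtain ⟨B, hB, rfl⟩ := Finset.mem_image.1 hA
    exact h.sdiff_top_subset (hfin.mem_toFinset.1 hB)
  refine ⟨∑ A ∈ 𝒜, if A ∈ configs L then f A else 0,
    ∑ A ∈ 𝒜, if A ∈ configs (L \ {v}) then f A else 0,
    fun q => ∑ A ∈ 𝒜, if A ∪ ({q} : Finset Kind).image (topRhombus v) ∈ configs L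
      then f A else 0, fun g => ⟨?_, ?_⟩⟩
  · rw [sum_eq_sum_sum_union_image (topRhombus_injective v) hfin.toFinset 𝒜
      (fun A hA q hq => topRhombus_notMem_commonRhombi L v q (hsub A hA hq))
      (fun A hA => Finset.mem_image_of_mem _ hA) f g]
    simp only [Finset.sum_mul]
    rw [Finset.sum_comm (s := Finset.univ) (t := 𝒜), ← Finset.sum_add_distrib,
      ← Finset.sum_add_distrib]
    refine Finset.sum_congr rfl fun A hA => ?_
    simp only [sum_finset_kind, hfin.mem_toFinset, h.univ_notMem_configs (hsub A hA),
      h.compl_singleton_mem_configs_iff (hsub A hA), Finset.image_empty, Finset.union_empty,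
      if_false, add_zero, Finset.mul_sum, ite_mul, zero_mul]
  · rw [sum_eq_sum_sum_union_image (bottomRhombus_injective v) hfin'.toFinset 𝒜
      (fun A hA q hq => h.commonRhombi_ne_bottom (hsub A hA hq)) (fun A hA => ?_) f g]
    · simp only [Finset.sum_mul]
      rw [Finset.sum_comm (s := Finset.univ) (t := 𝒜), ← Finset.sum_add_distrib,
        ← Finset.sum_add_distrib]
      refine Finset.sum_congr rfl fun A hA => ?_
      simp only [sum_finset_kind, hfin'.mem_toFinset, h.univ_notMem_configs_sdiff (hsub A hA),
        h.compl_singleton_mem_configs_sdiff_iff (hsub A hA), h.singleton_mem_configs_iff (hsub A hA),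
        Finset.image_empty, Finset.union_empty,
        if_false, add_zero, Finset.mul_sum, ite_mul, zero_mul]
      ring
    · obtain ⟨B, hB, e⟩ := h.exists_config_eq_sdiff (hfin'.mem_toFinset.1 hA)
      exact Finset.mem_image.2 ⟨B, hfin.mem_toFinset.2 hB, e.symm⟩

end IsTop

/-! ### The octant -/

/-- The coordinate of a point in the direction `unit q`. -/
def coord : Kind → Vertex → ℤ
  | .a, v => v.1
  | .b, v => v.2.1
  | .c, v => v.2.2

theorem add_unit_le_zero_iff {v : Vertex} (hv : v ≤ 0) (q : Kind) :
    v + unit q ≤ 0 ↔ coord q v ≠ 0 := by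
  obtain ⟨i, j, k⟩ := v
  cases q <;> simp only [Prod.le_def, Prod.fst_zero, Prod.snd_zero, unit, coord,
    Prod.mk_add_mk] at * <;> omega

theorem isLowerSystem_Iic : IsLowerSystem (Set.Iic 0) where
  nonpos _ hv := hv
  finite_compl := by
    have : {v : Vertex | v ≤ 0 ∧ v ∉ Set.Iic 0} = ∅ := by
      ext v; simp
    rw [this]
    exact Set.finite_empty
  lower _ hv _ hu := hu.trans hv

theorem mem_rhombi_Iic {q : Kind} {v : Vertex} :
    (q, v) ∈ rhombi (Set.Iic 0) ↔ v ≤ 0 ∧ coord q v = 0 := by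
  rw [mem_rhombi, Set.mem_Iic, Set.mem_Iic]
  refine and_congr_right fun hv => ?_
  rw [add_unit_le_zero_iff hv, not_not]

theorem mem_boundary_Iic {v : Vertex} :
    v ∈ boundary (Set.Iic 0) ↔ v ≤ 0 ∧ ∃ q, coord q v = 0 := by
  obtain ⟨i, j, k⟩ := v
  constructor
  · rintro ⟨h1, h2⟩
    refine ⟨h1, ?_⟩
    simp only [Set.mem_Iic, Prod.le_def, Prod.fst_zero, Prod.snd_zero, Prod.mk_add_mk] at h1 h2
    by_cases hi : i = 0
    · exact ⟨.a, hi⟩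
    · by_cases hj : j = 0
      · exact ⟨.b, hj⟩
      · exact ⟨.c, show k = 0 by omega⟩
  · rintro ⟨h1, q, hq⟩
    refine ⟨h1, ?_⟩
    cases q <;> simp only [Set.mem_Iic, Prod.le_def, Prod.fst_zero, Prod.snd_zero, Prod.mk_add_mk,
      coord] at * <;> omega

/-- The end, on a coordinate axis, of the path of short diagonals through a boundary point of the
octant. -/
def pathEnd (v : Vertex) : Vertex :=
  (min 0 (v.1 - min v.2.1 v.2.2), min 0 (v.2.1 - min v.1 v.2.2), min 0 (v.2.2 - min v.1 v.2.1))

/-- The short diagonals of the octant's boundary form disjoint paths bent at the axes, with three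
branches at the origin. `pathEnd` is constant along them and, by the next lemma, differs at the two
ends of each long diagonal. -/
theorem pathEnd_sub {q : Kind} {v : Vertex} (hv : v ≤ 0) (hq : coord q v = 0) :
    pathEnd (v - unit q.next - unit q.prev) = pathEnd v := by
  obtain ⟨i, j, k⟩ := v
  cases q <;> simp only [Prod.le_def, Prod.fst_zero, Prod.snd_zero, coord, pathEnd, unit,
    Kind.next, Kind.prev, Prod.mk_sub_mk, Prod.mk.injEq] at * <;> omega

theorem pathEnd_sub_next_ne {q : Kind} {v : Vertex} (hv : v ≤ 0) (hq : coord q v = 0) :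
    pathEnd (v - unit q.next) ≠ pathEnd (v - unit q.prev) := by
  obtain ⟨i, j, k⟩ := v
  cases q <;> simp only [Prod.le_def, Prod.fst_zero, Prod.snd_zero, coord, pathEnd, unit,
    Kind.next, Kind.prev, Prod.mk_sub_mk, Prod.mk.injEq, ne_eq] at * <;> omega

theorem coord_sub {q : Kind} (v : Vertex) :
    coord q (v - unit q.next) = coord q v ∧ coord q (v - unit q.prev) = coord q v := by
  cases q <;> simp [coord, unit, Kind.next, Kind.prev]

theorem sub_unit_le {v : Vertex} (hv : v ≤ 0) (q : Kind) : v - unit q ≤ 0 :=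
  (sub_le_self v (unit_nonneg q)).trans hv

/-- Within one coordinate plane a path is a single half-line of direction `-(unit q.next + unit
q.prev)`. -/
theorem exists_eq_sub_nsmul {q : Kind} {u s : Vertex} (hu : u ≤ 0) (hs : s ≤ 0)
    (hqu : coord q u = 0) (hqs : coord q s = 0) (h : pathEnd s = pathEnd u)
    (hle : height s ≤ height u) : ∃ t : ℕ, s = u - t • (unit q.next + unit q.prev) := by
  obtain ⟨i, j, k⟩ := u
  obtain ⟨i', j', k'⟩ := s
  simp only [height] at hle
  cases q
  · refine ⟨(j - j').toNat, ?_⟩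
    simp only [Prod.le_def, Prod.fst_zero, Prod.snd_zero, coord, pathEnd, unit,
      Kind.next, Kind.prev, Prod.mk_sub_mk, Prod.mk.injEq, Prod.mk_add_mk, Prod.smul_mk,
      nsmul_eq_mul, mul_zero, mul_one, add_zero, zero_add] at *
    omega
  · refine ⟨(k - k').toNat, ?_⟩
    simp only [Prod.le_def, Prod.fst_zero, Prod.snd_zero, coord, pathEnd, unit,
      Kind.next, Kind.prev, Prod.mk_sub_mk, Prod.mk.injEq, Prod.mk_add_mk, Prod.smul_mk,
      nsmul_eq_mul, mul_zero, mul_one, add_zero, zero_add] at *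
    omega
  · refine ⟨(i - i').toNat, ?_⟩
    simp only [Prod.le_def, Prod.fst_zero, Prod.snd_zero, coord, pathEnd, unit,
      Kind.next, Kind.prev, Prod.mk_sub_mk, Prod.mk.injEq, Prod.mk_add_mk, Prod.smul_mk,
      nsmul_eq_mul, mul_zero, mul_one, add_zero, zero_add] at *
    omega

theorem reachable_sub_nsmul {A : Set (Kind × Vertex)} {q : Kind} {u : Vertex} (hu : u ≤ 0)
    (hq : coord q u = 0) (hA : ∀ t : ℕ, (q, u - t • (unit q.next + unit q.prev)) ∉ A) (t : ℕ) :
    (configGraph (Set.Iic 0) A).Reachable u (u - t • (unit q.next + unit q.prev)) := by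
  have aux : ∀ t : ℕ, u - t • (unit q.next + unit q.prev) ≤ 0 ∧
      coord q (u - t • (unit q.next + unit q.prev)) = 0 := by
    intro t
    induction t with
    | zero => simpa using ⟨hu, hq⟩
    | succ t ih =>
      have e : u - (t + 1) • (unit q.next + unit q.prev) =
          u - t • (unit q.next + unit q.prev) - unit q.next - unit q.prev := by
        rw [succ_nsmul]; abel
      rw [e]
      exact ⟨sub_unit_le (sub_unit_le ih.1 _) _, by rw [(coord_sub _).2, (coord_sub _).1, ih.2]⟩
  induction t with
  | zero => simp
  | succ t ih =>
    refine ih.trans (reachable_of_mem_edges ?_)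
    have e : u - (t + 1) • (unit q.next + unit q.prev) =
        u - t • (unit q.next + unit q.prev) - unit q.next - unit q.prev := by
      rw [succ_nsmul]; abel
    rw [e, ← shortDiag_eq]
    exact shortDiag_mem_configEdges.2 ⟨mem_rhombi_Iic.2 (aux t), hA t⟩

theorem pathEnd_eq_of_reachable {u s : Vertex}
    (h : (configGraph (Set.Iic 0) ∅).Reachable u s) : pathEnd u = pathEnd s := by
  have := reachable_map_of_edges (G := (⊥ : SimpleGraph Vertex)) pathEnd ?_ h
  · simpa using this
  rintro d ⟨⟨q, v⟩, hr, ⟨hA, -⟩ | ⟨-, rfl⟩⟩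
  · exact absurd hA (Set.notMem_empty _)
  · obtain ⟨hv, hq⟩ := mem_rhombi_Iic.1 hr
    refine ⟨_, _, shortDiag_eq q v, ?_⟩
    rw [pathEnd_sub hv hq]

theorem pathEnd_facts {q : Kind} {u : Vertex} (hu : u ≤ 0) (hq : coord q u = 0) :
    pathEnd u ≤ 0 ∧ coord q (pathEnd u) = 0 ∧ pathEnd (pathEnd u) = pathEnd u ∧
      height u ≤ height (pathEnd u) := by
  obtain ⟨i, j, k⟩ := u
  cases q <;> simp only [Prod.le_def, Prod.fst_zero, Prod.snd_zero, coord, pathEnd, height,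
    Prod.mk.injEq] at * <;> omega

theorem reachable_pathEnd {q : Kind} {u : Vertex} (hu : u ≤ 0) (hq : coord q u = 0) :
    (configGraph (Set.Iic 0) ∅).Reachable (pathEnd u) u := by
  obtain ⟨h1, h2, h3, h4⟩ := pathEnd_facts hu hq
  obtain ⟨t, ht⟩ := exists_eq_sub_nsmul h1 hu h2 hq h3.symm h4
  nth_rewrite 2 [ht]
  exact reachable_sub_nsmul h1 h2 (fun _ => Set.notMem_empty _) t

theorem reachable_of_pathEnd_eq {u s : Vertex} (hu : u ∈ boundary (Set.Iic 0))
    (hs : s ∈ boundary (Set.Iic 0)) (h : pathEnd u = pathEnd s) :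
    (configGraph (Set.Iic 0) ∅).Reachable u s := by
  obtain ⟨hu, q, hq⟩ := mem_boundary_Iic.1 hu
  obtain ⟨hs, r, hr⟩ := mem_boundary_Iic.1 hs
  exact (reachable_pathEnd hu hq).symm.trans (h ▸ reachable_pathEnd hs hr)

/-- The element of `anchors N` on the path with the given end. -/
def anchorOf (N : ℤ) : Vertex → Set Vertex
  | (x, y, z) =>
    if z < 0 then
      if z ≤ -N - 1 then {(0, 0, z)}
      else {(0, (-N - 1 - z) / 2, (-N - 1 - z) / 2 + z), ((-N - 1 - z) / 2, 0, (-N - 1 - z) / 2 + z)}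
    else if y < 0 then
      if y ≤ -N - 1 then {(0, y, 0)}
      else {((-N - 1 - y) / 2, (-N - 1 - y) / 2 + y, 0), (0, (-N - 1 - y) / 2 + y, (-N - 1 - y) / 2)}
    else if x < 0 then
      if x ≤ -N - 1 then {(x, 0, 0)}
      else {((-N - 1 - x) / 2 + x, 0, (-N - 1 - x) / 2), ((-N - 1 - x) / 2 + x, (-N - 1 - x) / 2, 0)}
    else {(0, (-N - 1) / 2, (-N - 1) / 2), ((-N - 1) / 2, 0, (-N - 1) / 2),
      ((-N - 1) / 2, (-N - 1) / 2, 0)}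

theorem eq_anchorOf {N : ℤ} (hN : 0 ≤ N) {S : Set Vertex} (hS : S ∈ anchors N) {s : Vertex}
    (hs : s ∈ S) : S = anchorOf N (pathEnd s) := by
  rcases hS with (⟨p, q, h1, h2, h3, rfl | rfl | rfl⟩ | ⟨p, h1, rfl⟩) | ⟨q, h1, rfl | rfl | rfl⟩
  · have e : pathEnd s = (0, 0, q - p) := by
      rcases hs with rfl | rfl <;> simp only [pathEnd, Prod.mk.injEq] <;> omega
    -- Of `-N - 1` and `-N - 2`, exactly one has the parity of `q - p`; rounding down treats both at
    -- once, so each path carries a single anchor.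
    have e1 : (-N - 1 - (q - p)) / 2 = p := by omega
    rw [e, anchorOf, if_pos (by omega), if_neg (by omega), e1, add_sub_cancel]
  · have e : pathEnd s = (0, q - p, 0) := by
      rcases hs with rfl | rfl <;> simp only [pathEnd, Prod.mk.injEq] <;> omega
    have e1 : (-N - 1 - (q - p)) / 2 = p := by omega
    rw [e, anchorOf, if_neg (by omega), if_pos (by omega), if_neg (by omega), e1, add_sub_cancel]
  · have e : pathEnd s = (q - p, 0, 0) := by
      rcases hs with rfl | rfl <;> simp only [pathEnd, Prod.mk.injEq] <;> omega
    have e1 : (-N - 1 - (q - p)) / 2 = p := by omega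
    rw [e, anchorOf, if_neg (by omega), if_neg (by omega), if_pos (by omega), if_neg (by omega),
      e1, add_sub_cancel]
  · have e : pathEnd s = (0, 0, 0) := by
      rcases hs with rfl | rfl | rfl <;> simp only [pathEnd, Prod.mk.injEq] <;> omega
    have e1 : (-N - 1) / 2 = p := by omega
    rw [e, anchorOf, if_neg (by omega), if_neg (by omega), if_neg (by omega), e1]
  · have e : pathEnd s = (0, 0, q) := by
      obtain rfl := hs; simp only [pathEnd, Prod.mk.injEq]; omega
    rw [e, anchorOf, if_pos (by omega), if_pos (by omega)]
  · have e : pathEnd s = (0, q, 0) := by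
      obtain rfl := hs; simp only [pathEnd, Prod.mk.injEq]; omega
    rw [e, anchorOf, if_neg (by omega), if_pos (by omega), if_pos (by omega)]
  · have e : pathEnd s = (q, 0, 0) := by
      obtain rfl := hs; simp only [pathEnd, Prod.mk.injEq]; omega
    rw [e, anchorOf, if_neg (by omega), if_neg (by omega), if_pos (by omega), if_pos (by omega)]

theorem pathEnd_cases {u : Vertex} (hu : u ∈ boundary (Set.Iic 0)) :
    pathEnd u = (0, 0, 0) ∨ ∃ m < 0,
      pathEnd u = (0, 0, m) ∨ pathEnd u = (0, m, 0) ∨ pathEnd u = (m, 0, 0) := by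
  obtain ⟨hu, q, hq⟩ := mem_boundary_Iic.1 hu
  obtain ⟨i, j, k⟩ := u
  by_cases h1 : pathEnd (i, j, k) = (0, 0, 0)
  · exact .inl h1
  refine .inr ?_
  by_cases hi : i < j ∧ i < k
  · refine ⟨i - min j k, by omega, .inr (.inr ?_)⟩
    cases q <;> simp only [Prod.le_def, Prod.fst_zero, Prod.snd_zero, coord, pathEnd,
      Prod.mk.injEq] at * <;> omega
  by_cases hj : j < i ∧ j < k
  · refine ⟨j - min i k, by omega, .inr (.inl ?_)⟩
    cases q <;> simp only [Prod.le_def, Prod.fst_zero, Prod.snd_zero, coord, pathEnd,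
      Prod.mk.injEq] at * <;> omega
  · refine ⟨k - min i j, ?_, .inl ?_⟩ <;>
    cases q <;> simp only [Prod.le_def, Prod.fst_zero, Prod.snd_zero, coord, pathEnd,
      Prod.mk.injEq] at * <;> omega

/-- The last clause lets one descend from `u` to the anchor without leaving its coordinate plane.
The singleton anchors on the axes cannot obstruct it: they sit at the end of their path, the highest
point, so the whole path has height below `-N`. -/
theorem exists_mem_anchors {N : ℤ} (hN : 0 ≤ N) {u : Vertex} (hu : u ∈ boundary (Set.Iic 0)) :
    ∃ S ∈ anchors N, (∀ s ∈ S, s ∈ boundary (Set.Iic 0) ∧ pathEnd s = pathEnd u) ∧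
      ∀ q, coord q u = 0 → -N ≤ height u → ∃ s ∈ S, coord q s = 0 := by
  have hbdry : ∀ (q : Kind) (s : Vertex), s.1 ≤ 0 → s.2.1 ≤ 0 → s.2.2 ≤ 0 → coord q s = 0 →
      s ∈ boundary (Set.Iic 0) := fun q s h1 h2 h3 h => mem_boundary_Iic.2 ⟨⟨h1, h2, h3⟩, q, h⟩
  have hneg := (mem_boundary_Iic.1 hu).1
  rcases pathEnd_cases hu with e | ⟨m, hm, e | e | e⟩
  · obtain ⟨p, hp⟩ : ∃ p, 2 * p = -N - 1 ∨ 2 * p = -N - 2 := ⟨(-N - 1) / 2, by omega⟩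
    refine ⟨_, .inl (.inr ⟨p, hp, rfl⟩), ?_, ?_⟩
    · rintro s (rfl | rfl | rfl)
      · refine ⟨hbdry .a _ ?_ ?_ ?_ rfl, ?_⟩ <;> (try rw [e]) <;>
        simp only [pathEnd, Prod.mk.injEq] <;> omega
      · refine ⟨hbdry .b _ ?_ ?_ ?_ rfl, ?_⟩ <;> (try rw [e]) <;>
        simp only [pathEnd, Prod.mk.injEq] <;> omega
      · refine ⟨hbdry .c _ ?_ ?_ ?_ rfl, ?_⟩ <;> (try rw [e]) <;>
        simp only [pathEnd, Prod.mk.injEq] <;> omega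
    · rintro (_ | _ | _) - -
      · exact ⟨(0, p, p), by simp, rfl⟩
      · exact ⟨(p, 0, p), by simp, rfl⟩
      · exact ⟨(p, p, 0), by simp, rfl⟩
  · by_cases hmN : m ≤ -N - 1
    · refine ⟨_, .inr ⟨m, hmN, .inl rfl⟩, ?_, ?_⟩
      · rintro s rfl
        refine ⟨hbdry .a _ ?_ ?_ ?_ rfl, ?_⟩ <;> (try rw [e]) <;>
        simp only [pathEnd, Prod.mk.injEq] <;> omega
      · intro q hq hh
        have := (pathEnd_facts hneg hq).2.2.2
        rw [e] at this
        simp only [height] at this hh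
        omega
    · obtain ⟨p, hp⟩ : ∃ p, 2 * p = -N - 1 - m ∨ 2 * p = -N - 2 - m := ⟨(-N - 1 - m) / 2, by omega⟩
      refine ⟨_, .inl (.inl ⟨p, p + m, by omega, by omega, by omega, .inl rfl⟩), ?_, ?_⟩
      · rintro s (rfl | rfl)
        · refine ⟨hbdry .a _ ?_ ?_ ?_ rfl, ?_⟩ <;> (try rw [e]) <;>
        simp only [pathEnd, Prod.mk.injEq] <;> omega
        · refine ⟨hbdry .b _ ?_ ?_ ?_ rfl, ?_⟩ <;> (try rw [e]) <;>
        simp only [pathEnd, Prod.mk.injEq] <;> omega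
      · rintro (_ | _ | _) hq -
        · exact ⟨_, .inl rfl, rfl⟩
        · exact ⟨_, .inr rfl, rfl⟩
        · have := (pathEnd_facts hneg hq).2.1
          rw [e] at this
          exact absurd this hm.ne
  · by_cases hmN : m ≤ -N - 1
    · refine ⟨_, .inr ⟨m, hmN, .inr (.inl rfl)⟩, ?_, ?_⟩
      · rintro s rfl
        refine ⟨hbdry .a _ ?_ ?_ ?_ rfl, ?_⟩ <;> (try rw [e]) <;>
        simp only [pathEnd, Prod.mk.injEq] <;> omega
      · intro q hq hh
        have := (pathEnd_facts hneg hq).2.2.2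
        rw [e] at this
        simp only [height] at this hh
        omega
    · obtain ⟨p, hp⟩ : ∃ p, 2 * p = -N - 1 - m ∨ 2 * p = -N - 2 - m := ⟨(-N - 1 - m) / 2, by omega⟩
      refine ⟨_, .inl (.inl ⟨p, p + m, by omega, by omega, by omega, .inr (.inl rfl)⟩), ?_, ?_⟩
      · rintro s (rfl | rfl)
        · refine ⟨hbdry .c _ ?_ ?_ ?_ rfl, ?_⟩ <;> (try rw [e]) <;>
        simp only [pathEnd, Prod.mk.injEq] <;> omega
        · refine ⟨hbdry .a _ ?_ ?_ ?_ rfl, ?_⟩ <;> (try rw [e]) <;>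
        simp only [pathEnd, Prod.mk.injEq] <;> omega
      · rintro (_ | _ | _) hq -
        · exact ⟨_, .inr rfl, rfl⟩
        · have := (pathEnd_facts hneg hq).2.1
          rw [e] at this
          exact absurd this hm.ne
        · exact ⟨_, .inl rfl, rfl⟩
  · by_cases hmN : m ≤ -N - 1
    · refine ⟨_, .inr ⟨m, hmN, .inr (.inr rfl)⟩, ?_, ?_⟩
      · rintro s rfl
        refine ⟨hbdry .b _ ?_ ?_ ?_ rfl, ?_⟩ <;> (try rw [e]) <;>
        simp only [pathEnd, Prod.mk.injEq] <;> omega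
      · intro q hq hh
        have := (pathEnd_facts hneg hq).2.2.2
        rw [e] at this
        simp only [height] at this hh
        omega
    · obtain ⟨p, hp⟩ : ∃ p, 2 * p = -N - 1 - m ∨ 2 * p = -N - 2 - m := ⟨(-N - 1 - m) / 2, by omega⟩
      refine ⟨_, .inl (.inl ⟨p, p + m, by omega, by omega, by omega, .inr (.inr rfl)⟩), ?_, ?_⟩
      · rintro s (rfl | rfl)
        · refine ⟨hbdry .b _ ?_ ?_ ?_ rfl, ?_⟩ <;> (try rw [e]) <;>
        simp only [pathEnd, Prod.mk.injEq] <;> omega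
        · refine ⟨hbdry .c _ ?_ ?_ ?_ rfl, ?_⟩ <;> (try rw [e]) <;>
        simp only [pathEnd, Prod.mk.injEq] <;> omega
      · rintro (_ | _ | _) hq -
        · have := (pathEnd_facts hneg hq).2.1
          rw [e] at this
          exact absurd this hm.ne
        · exact ⟨_, .inl rfl, rfl⟩
        · exact ⟨_, .inr rfl, rfl⟩

theorem mem_boundary_Iic_of_mem_anchors {N : ℤ} (hN : 0 ≤ N) {S : Set Vertex}
    (hS : S ∈ anchors N) {s : Vertex} (hs : s ∈ S) : s ∈ boundary (Set.Iic 0) := by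
  rw [mem_boundary_Iic]
  have h : s ≤ 0 ∧ (coord .a s = 0 ∨ coord .b s = 0 ∨ coord .c s = 0) := by
    obtain ⟨i, j, k⟩ := s
    rcases hS with
      (⟨p, q, h1, h2, h3, rfl | rfl | rfl⟩ | ⟨p, h1, rfl⟩) | ⟨q, h1, rfl | rfl | rfl⟩ <;>
    · simp only [Set.mem_insert_iff, Set.mem_singleton_iff, Prod.mk.injEq] at hs
      simp only [Prod.le_def, Prod.fst_zero, Prod.snd_zero, coord]
      omega
  obtain ⟨h0, h | h | h⟩ := h
  exacts [⟨h0, _, h⟩, ⟨h0, _, h⟩, ⟨h0, _, h⟩]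

theorem empty_mem_configs_Iic : ∅ ∈ configs (Set.Iic 0) := by
  refine ⟨by simp, ?_⟩
  rw [Finset.coe_empty]
  filter_upwards [eventually_ge_atTop 0] with N hN
  constructor
  · intro v hv
    obtain ⟨S, hS, h, -⟩ := exists_mem_anchors hN hv
    refine ⟨S, ⟨hS, fun u hu => reachable_of_pathEnd_eq hv (h u hu).1 (h u hu).2.symm⟩, ?_⟩
    rintro S' ⟨hS', h'⟩
    obtain ⟨s, hs⟩ := nonempty_of_mem_anchors hS
    obtain ⟨s', hs'⟩ := nonempty_of_mem_anchors hS'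
    rw [eq_anchorOf hN hS hs, eq_anchorOf hN hS' hs', (h s hs).2,
      pathEnd_eq_of_reachable (h' s' hs')]
  · intro S hS
    obtain ⟨s, hs⟩ := nonempty_of_mem_anchors hS
    have hsb := mem_boundary_Iic_of_mem_anchors hN hS hs
    refine ⟨s, hsb, ?_⟩
    obtain ⟨S', hS', h, -⟩ := exists_mem_anchors hN hsb
    obtain ⟨s', hs'⟩ := nonempty_of_mem_anchors hS'
    obtain rfl : S = S' := by
      rw [eq_anchorOf hN hS hs, eq_anchorOf hN hS' hs', (h s' hs').2]
    exact fun u hu => reachable_of_pathEnd_eq hsb (h u hu).1 (h u hu).2.symm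

/-- Take a long diagonal of a lowest rhombus. Below it, the half-lines from its two ends carry short
diagonals only and run into different anchors, so the long diagonal would put two anchors into one
component. -/
theorem eq_empty_of_mem_configs_Iic {A : Finset (Kind × Vertex)}
    (hA : A ∈ configs (Set.Iic 0)) : A = ∅ := by
  by_contra hne
  obtain ⟨⟨q, x⟩, hx, hmin⟩ :=
    A.exists_min_image (fun r => height r.2) (Finset.nonempty_iff_ne_empty.2 hne)
  obtain ⟨hx0, hq⟩ := mem_rhombi_Iic.1 (hA.1 hx)
  have hdeep : ∀ r : Kind, ∀ t : ℕ, (q, x - unit r - t • (unit q.next + unit q.prev)) ∉ A := by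
    intro r t ht
    have h1 := hmin _ ht
    have h2 : ∀ t : ℕ, 0 ≤ height (t • (unit q.next + unit q.prev)) := by
      intro t
      induction t with
      | zero => simp [height]
      | succ t ih => rw [succ_nsmul, height_add, height_add, height_unit, height_unit]; omega
    have h3 := h2 t
    simp only [height_sub, height_unit] at h1
    omega
  -- The bound `1 - height x` ensures that the points `x - unit r`, of height `height x - 1`, are
  -- not below level `-N`, hence lie above their anchors.
  obtain ⟨N, ⟨hN1, hN2⟩, hN0, hNx⟩ :=
    (hA.2.and ((eventually_ge_atTop 0).and (eventually_ge_atTop (1 - height x)))).exists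
  have key : ∀ r : Kind, coord q (x - unit r) = 0 → x - unit r ∈ boundary (Set.Iic 0) ∧
      ∃ S ∈ anchors N, (∀ s ∈ S, (configGraph (Set.Iic 0) A).Reachable (x - unit r) s) ∧
        (∀ s ∈ S, pathEnd s = pathEnd (x - unit r)) := by
    intro r hr
    have hle := sub_unit_le hx0 r
    have hb : x - unit r ∈ boundary (Set.Iic 0) := mem_boundary_Iic.2 ⟨hle, q, hr⟩
    have hh : height (x - unit r) = height x - 1 := by rw [height_sub, height_unit]
    obtain ⟨S, hS, hS1, hS2⟩ := exists_mem_anchors hN0 hb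
    refine ⟨hb, S, hS, ?_, fun s hs => (hS1 s hs).2⟩
    obtain ⟨s, hs, hqs⟩ := hS2 q hr (by omega)
    have hsN := height_lt_of_mem_anchors hS hs
    obtain ⟨t, rfl⟩ := exists_eq_sub_nsmul hle (mem_boundary_Iic.1 (hS1 s hs).1).1 hr hqs
      (hS1 s hs).2 (by omega)
    obtain ⟨w, -, hw⟩ := hN2 S hS
    exact fun s' hs' => (reachable_sub_nsmul hle hr (hdeep r) t).trans
      ((hw _ hs).symm.trans (hw _ hs'))
  obtain ⟨hb, S, hS, hr, he⟩ := key q.next (by rw [(coord_sub x).1, hq])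
  obtain ⟨-, S', hS', hr', he'⟩ := key q.prev (by rw [(coord_sub x).2, hq])
  have hlong : (configGraph (Set.Iic 0) A).Reachable (x - unit q.next) (x - unit q.prev) := by
    refine reachable_of_mem_edges ?_
    rw [← longDiag_eq]
    exact longDiag_mem_configEdges.2 ⟨hA.1 hx, hx⟩
  obtain rfl : S = S' := (hN1 _ hb).unique ⟨hS, hr⟩ ⟨hS', fun s hs => hlong.trans (hr' s hs)⟩
  obtain ⟨s, hs⟩ := nonempty_of_mem_anchors hS
  exact pathEnd_sub_next_ne hx0 hq ((he s hs).symm.trans (he' s hs))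

theorem configs_Iic : configs (Set.Iic 0) = {∅} :=
  Set.eq_singleton_iff_unique_mem.2
    ⟨empty_mem_configs_Iic, fun _ => eq_empty_of_mem_configs_Iic⟩

/-! ### Descending from one lower system to a smaller one -/

/-- A minimal point of the finite set `M \ L` can be added to `L`; it is maximal in the result, and
deleting it again gives back `L`. -/
theorem lowerSystem_induction {M : Set Vertex} (hM : IsLowerSystem M) {P : Set Vertex → Prop}
    (base : P M) (step : ∀ L v, IsTop L v → L ⊆ M → P L → P (L \ {v})) :
    ∀ L, IsLowerSystem L → L ⊆ M → P L := by
  have main : ∀ n : ℕ, ∀ L, IsLowerSystem L → L ⊆ M → (M \ L).ncard = n → P L := by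
    intro n
    induction n using Nat.strong_induction_on with
    | _ n ih =>
      intro L hL hLM hn
      have hfin : (M \ L).Finite :=
        hL.finite_compl.subset fun x hx => ⟨hM.nonpos x hx.1, hx.2⟩
      rcases (M \ L).eq_empty_or_nonempty with h | h
      · rwa [← hLM.antisymm (Set.sdiff_eq_empty.1 h)] at base
      obtain ⟨x, hx⟩ := hfin.exists_minimal h
      have hxL : x ∉ L := hx.1.2
      have hlow : ∀ u ≤ x, u ∈ insert x L := by
        intro u hu
        by_cases huL : u ∈ L
        · exact .inr huL
        · exact .inl (le_antisymm hu (hx.2 ⟨hM.lower x hx.1.1 u hu, huL⟩ hu))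
      have hL' : IsLowerSystem (insert x L) := by
        refine ⟨?_, hL.finite_compl.subset fun u hu => ⟨hu.1, fun h => hu.2 (.inr h)⟩, ?_⟩
        · rintro u (rfl | hu)
          exacts [hM.nonpos _ hx.1.1, hL.nonpos _ hu]
        · rintro u (rfl | hu) w hw
          exacts [hlow w hw, .inr (hL.lower u hu w hw)]
      have htop : IsTop (insert x L) x := by
        refine ⟨hL', .inl rfl, ?_⟩
        rintro q (h | h)
        · exact unit_ne_zero q (by simpa using h)
        · exact hxL (hL.lower _ h _ (by simpa using unit_nonneg q))
      have hsub : insert x L ⊆ M := Set.insert_subset hx.1.1 hLM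
      have hcard : (M \ insert x L).ncard < n := by
        rw [← hn]
        refine Set.ncard_lt_ncard ⟨Set.sdiff_subset_sdiff_right (Set.subset_insert x L), ?_⟩ hfin
        exact fun h => (h hx.1).2 (.inl rfl)
      have := step _ x htop hsub (ih _ hcard _ hL' hsub rfl)
      rwa [Set.insert_sdiff_self_of_notMem hxL] at this
  exact fun L hL hLM => main _ L hL hLM rfl

/-! ### Conductances -/

/-- The coefficients `U`, `V`, `W`, for the kinds `a`, `b`, `c`. -/
noncomputable def coeff (C : Sym2 Vertex → ℂ) : Kind → Vertex → ℂ
  | .a => coeffU C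
  | .b => coeffV C
  | .c => coeffW C

theorem sub_unit_eq (v : Vertex) :
    v - unit .a = v + (-1, 0, 0) ∧ v - unit .b = v + (0, -1, 0) ∧ v - unit .c = v + (0, 0, -1) := by
  refine ⟨?_, ?_, ?_⟩ <;> rw [sub_eq_add_neg] <;> simp [unit]

section Conductance

variable {C : Sym2 Vertex → ℂ}

theorem long_ne_zero (hC : IsConductance C) {v : Vertex} (hv : v ≤ 0) (q : Kind) :
    long C q v ≠ 0 := left_ne_zero_of_mul_eq_one (hC q v hv)

/-- The short conductance in the `Y`-`Δ` equation is the inverse of the long one on the same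
rhombus. -/
theorem long_eq_pairSum_mul (hC : IsConductance C) (hY : IsYDeltaConsistent C) {v : Vertex}
    (hv : v ≤ 0) (q : Kind) : long C q v = pairSum C v * long C q (v - unit q) := by
  have h : long C q v * short C q (v - unit q) = pairSum C v := by
    obtain ⟨h1, h2, h3⟩ := hY v hv
    obtain ⟨e1, e2, e3⟩ := sub_unit_eq v
    cases q
    · rw [e1, h1]
    · rw [e2, h2]
    · rw [e3, h3]
  have h' : long C q (v - unit q) * short C q (v - unit q) = 1 := hC q _ (sub_unit_le hv q)
  rw [← h]
  linear_combination -long C q v * h'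

theorem pairSum_ne_zero (hC : IsConductance C) (hY : IsYDeltaConsistent C) {v : Vertex}
    (hv : v ≤ 0) : pairSum C v ≠ 0 := by
  have h := long_ne_zero hC hv .a
  rw [long_eq_pairSum_mul hC hY hv] at h
  exact left_ne_zero_of_mul h

/-- `pairSum` is quadratic in the long conductances, each of which is `pairSum C v` times its
counterpart at the bottom of the cube. Hence `pairSum` equals its own square times `delta`. -/
theorem pairSum_mul_delta (hC : IsConductance C) (hY : IsYDeltaConsistent C) {v : Vertex}
    (hv : v ≤ 0) : pairSum C v * delta C v = 1 := by
  have h := pairSum_ne_zero hC hY hv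
  have h1 : pairSum C v = pairSum C v * (pairSum C v * delta C v) := by
    obtain ⟨e1, e2, e3⟩ := sub_unit_eq v
    conv_lhs => rw [pairSum, long_eq_pairSum_mul hC hY hv .a, long_eq_pairSum_mul hC hY hv .b,
      long_eq_pairSum_mul hC hY hv .c]
    rw [delta, ← e1, ← e2, ← e3]
    ring
  exact (mul_left_cancel₀ h (by rw [mul_one]; exact h1)).symm

/-- Expresses the coefficient through the top of the cube, where the numerator acquires the factor
`pairSum C v ^ 2` and `delta C v` is the inverse of `pairSum C v`. -/
theorem coeff_eq (hC : IsConductance C) (hY : IsYDeltaConsistent C) {v : Vertex}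
    (hv : v ≤ 0) (q : Kind) :
    coeff C q v = long C q.next v * long C q.prev v / pairSum C v := by
  have h := pairSum_ne_zero hC hY hv
  have hd := pairSum_mul_delta hC hY hv
  have hd0 : delta C v ≠ 0 := right_ne_zero_of_mul_eq_one hd
  obtain ⟨e1, e2, e3⟩ := sub_unit_eq v
  rw [long_eq_pairSum_mul hC hY hv q.next, long_eq_pairSum_mul hC hY hv q.prev]
  cases q <;> simp only [coeff, coeffU, coeffV, coeffW, Kind.next, Kind.prev] <;>
    simp only [← e1, ← e2, ← e3] <;> field_simp
  · linear_combination (-(long C .b (v - unit .b) * long C .c (v - unit .c))) * hd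
  · linear_combination (-(long C .a (v - unit .a) * long C .c (v - unit .c))) * hd
  · linear_combination (-(long C .a (v - unit .a) * long C .b (v - unit .b))) * hd

theorem coeff_sum (hC : IsConductance C) (hY : IsYDeltaConsistent C) {v : Vertex}
    (hv : v ≤ 0) : coeff C .a v + coeff C .b v + coeff C .c v = 1 := by
  have h := pairSum_ne_zero hC hY hv
  rw [coeff_eq hC hY hv, coeff_eq hC hY hv, coeff_eq hC hY hv, ← add_div, ← add_div,
    div_eq_one_iff_eq h, pairSum]
  simp only [Kind.next, Kind.prev]
  ring

end Conductance

/-! ### Partition functions and edge probabilities under a cube move -/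

theorem configWeight_eq (C : Sym2 Vertex → ℂ) {T : Kind → Kind × Vertex}
    (hT : Function.Injective T) (A : Finset (Kind × Vertex)) :
    configWeight C A = configWeight C (A \ Finset.univ.image T) *
      ∏ q ∈ Finset.univ.filter fun q => T q ∈ A, long C (T q).1 (T q).2 := by
  conv_lhs => rw [← sdiff_union_image_filter T A]
  rw [configWeight, Finset.prod_union, configWeight, Finset.prod_image hT.injOn]
  refine Finset.disjoint_left.2 fun r h1 h2 => (Finset.mem_sdiff.1 h1).2 ?_
  exact Finset.image_subset_image (Finset.filter_subset _ _) h2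

theorem prod_compl_singleton (g : Kind → ℂ) (q : Kind) :
    ∏ r ∈ ({q}ᶜ : Finset Kind), g r = g q.next * g q.prev := by
  rw [Kind.compl_singleton, Finset.prod_pair q.next_ne_prev]

theorem sum_ite_mem_singleton (y g : Kind → ℂ) (r : Kind) :
    ∑ q, y q * (if r ∈ ({q} : Finset Kind) then ∏ p ∈ ({q} : Finset Kind), g p else 0) =
      y r * g r := by
  simp

theorem sum_ite_mem_compl_singleton (g : Kind → ℂ) (r : Kind) :
    ∑ q, (if r ∈ ({q}ᶜ : Finset Kind) then ∏ p ∈ ({q}ᶜ : Finset Kind), g p else 0) =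
      g r * g r.next + g r * g r.prev := by
  simp only [prod_compl_singleton, sum_kind]
  cases r <;> simp [Kind.next, Kind.prev] <;> ring

/-- Here `α, β, γ` are the top conductances and `Z` the top partition function. A configuration
counted in `t` has two long diagonals at the top, so the three probabilities add up to `(Z - x + t *
s) / Z`, and the creation rate is `(x - t * s) / Z`. -/
theorem edge_probability_identity {α β γ s x t y₁ y₂ y₃ Z : ℂ} (hs : s = α * β + α * γ + β * γ)
    (hs0 : s ≠ 0) (hZ : Z = x + (y₁ * α + y₂ * β + y₃ * γ) + t * s) (hZ0 : Z ≠ 0) :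
    (y₁ * (α / s) + x * ((α / s) * (β / s) + (α / s) * (γ / s))) / (Z / s) =
      (y₁ * α + t * (α * β + α * γ)) / Z + (1 - β * γ / s) *
        (1 - (y₁ * α + t * (α * β + α * γ)) / Z - (y₂ * β + t * (α * β + β * γ)) / Z -
          (y₃ * γ + t * (α * γ + β * γ)) / Z) := by
  have h1 : 1 - β * γ / s = (α * β + α * γ) / s := by
    field_simp
    linear_combination hs
  have h2 : 1 - (y₁ * α + t * (α * β + α * γ)) / Z - (y₂ * β + t * (α * β + β * γ)) / Z -
      (y₃ * γ + t * (α * γ + β * γ)) / Z = (x - t * s) / Z := by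
    field_simp
    linear_combination hZ + 2 * t * hs
  rw [h1, h2]
  field_simp
  ring

namespace IsTop

variable {C : Sym2 Vertex → ℂ} {L : Set Vertex} {v : Vertex}

theorem nonpos (h : IsTop L v) : v ≤ 0 := h.isLowerSystem.nonpos v h.mem

/-- Holds separately for each of the sums of `exists_sums`: the `x` part by `pairSum_mul_delta`, the
`y` parts by `long_eq_pairSum_mul`, the `t` part by the definition of `pairSum`. The function `f` of
the part outside the cube is arbitrary, so this covers partition functions and probabilities alike.
-/
theorem sum_eq_pairSum_mul (h : IsTop L v) (hC : IsConductance C) (hY : IsYDeltaConsistent C)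
    (hfin : (configs L).Finite) (hfin' : (configs (L \ {v})).Finite)
    (f : Finset (Kind × Vertex) → ℂ) :
    ∑ A ∈ hfin.toFinset, f (A \ Finset.univ.image (topRhombus v)) *
        ∏ q ∈ Finset.univ.filter fun q => topRhombus v q ∈ A, long C q v =
      pairSum C v * ∑ A ∈ hfin'.toFinset, f (A \ Finset.univ.image (bottomRhombus v)) *
        ∏ q ∈ Finset.univ.filter fun q => bottomRhombus v q ∈ A, long C q (v - unit q) := by
  obtain ⟨x, t, y, hg⟩ := h.exists_sums hfin hfin' f
  rw [(hg fun S => ∏ q ∈ S, long C q v).1, (hg fun S => ∏ q ∈ S, long C q (v - unit q)).2]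
  simp only [prod_compl_singleton, Finset.prod_empty, Finset.prod_singleton, sum_kind, Kind.next,
    Kind.prev]
  have hd := pairSum_mul_delta hC hY h.nonpos
  obtain ⟨e1, e2, e3⟩ := sub_unit_eq v
  rw [delta, ← e1, ← e2, ← e3] at hd
  have ha := long_eq_pairSum_mul hC hY h.nonpos .a
  have hb := long_eq_pairSum_mul hC hY h.nonpos .b
  have hc := long_eq_pairSum_mul hC hY h.nonpos .c
  have hs : pairSum C v = long C .a v * long C .b v + long C .a v * long C .c v +
    long C .b v * long C .c v := rfl
  linear_combination y .a * ha + y .b * hb + y .c * hc - t * hs - x * hd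

theorem partitionFunction_eq (h : IsTop L v) (hC : IsConductance C) (hY : IsYDeltaConsistent C)
    (hfin : (configs L).Finite) :
    partitionFunction C (boundary L) = pairSum C v * partitionFunction C (boundary (L \ {v})) := by
  have hfin' := h.finite_configs_sdiff hfin
  rw [partitionFunction_boundary C h.isLowerSystem hfin, partitionFunction_boundary C h.sdiff hfin']
  rw [Finset.sum_congr rfl fun A _ => configWeight_eq C (topRhombus_injective v) A]
  refine (h.sum_eq_pairSum_mul hC hY hfin hfin' (configWeight C)).trans ?_
  congr 1
  exact Finset.sum_congr rfl fun A _ => (configWeight_eq C (bottomRhombus_injective v) A).symm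

/-- The event depends only on the part outside the cube, so numerator and denominator change by the
same factor. -/
theorem longProbOn_sdiff_of_common (h : IsTop L v) (hC : IsConductance C)
    (hY : IsYDeltaConsistent C) (hfin : (configs L).Finite) {q : Kind} {x : Vertex}
    (hx : (q, x) ∈ commonRhombi L v) :
    longProbOn C (boundary (L \ {v})) q x = longProbOn C (boundary L) q x := by
  classical
  have hfin' := h.finite_configs_sdiff hfin
  have key : ∀ {T : Kind → Kind × Vertex}, Function.Injective T → (∀ r, T r ∉ commonRhombi L v) →
      ∀ A : Finset (Kind × Vertex), (if (q, x) ∈ A then configWeight C A else 0) =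
        (if (q, x) ∈ A \ Finset.univ.image T then
          configWeight C (A \ Finset.univ.image T) else 0) *
        ∏ r ∈ Finset.univ.filter fun r => T r ∈ A, long C (T r).1 (T r).2 := by
    intro T hT hTc A
    have : (q, x) ∈ A \ Finset.univ.image T ↔ (q, x) ∈ A := by
      rw [Finset.mem_sdiff, and_iff_left_iff_imp]
      intro _ h'
      obtain ⟨r, -, e⟩ := Finset.mem_image.1 h'
      exact hTc r (e ▸ hx)
    simp only [this, ite_mul, zero_mul, ← configWeight_eq C hT]
  rw [longProbOn_boundary C h.isLowerSystem hfin, longProbOn_boundary C h.sdiff hfin',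
    h.partitionFunction_eq hC hY hfin]
  rw [Finset.sum_congr (s₁ := hfin.toFinset) rfl fun A _ =>
    key (topRhombus_injective v) (topRhombus_notMem_commonRhombi L v) A]
  have := h.sum_eq_pairSum_mul hC hY hfin hfin'
    (fun A => if (q, x) ∈ A then configWeight C A else 0)
  refine Eq.trans ?_ (congrArg (· / _) this.symm)
  rw [mul_div_mul_left _ _ (pairSum_ne_zero hC hY h.nonpos)]
  congr 1
  exact Finset.sum_congr rfl fun A _ => key (bottomRhombus_injective v)
    (fun _ => h.commonRhombi_ne_bottom) A

/-- Both sides are expressed through the same `x`, `y`, `t` of `exists_sums` and compared by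
`edge_probability_identity`. -/
theorem longProbOn_bottom (h : IsTop L v) (hC : IsConductance C)
    (hY : IsYDeltaConsistent C) (hfin : (configs L).Finite)
    (hZ : partitionFunction C (boundary L) ≠ 0) (q : Kind) :
    longProbOn C (boundary (L \ {v})) q (v - unit q) = longProbOn C (boundary L) q v +
      (1 - coeff C q v) * (1 - longProbOn C (boundary L) .a v - longProbOn C (boundary L) .b v -
        longProbOn C (boundary L) .c v) := by
  classical
  have hfin' := h.finite_configs_sdiff hfin
  obtain ⟨x, t, y, hg⟩ := h.exists_sums hfin hfin' (configWeight C)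
  have hs0 := pairSum_ne_zero hC hY h.nonpos
  have hZ' : partitionFunction C (boundary (L \ {v})) =
      partitionFunction C (boundary L) / pairSum C v := by
    rw [h.partitionFunction_eq hC hY hfin, mul_div_cancel_left₀ _ hs0]
  have hlong : ∀ r, long C r (v - unit r) = long C r v / pairSum C v := fun r => by
    rw [eq_div_iff hs0, long_eq_pairSum_mul hC hY h.nonpos r, mul_comm]
  have htop : ∀ r, longProbOn C (boundary L) r v = (y r * long C r v +
      t * (long C r v * long C r.next v + long C r v * long C r.prev v)) /
        partitionFunction C (boundary L) := by
    intro r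
    have hr := (hg fun S => if r ∈ S then ∏ q ∈ S, long C q v else 0).1
    rw [sum_ite_mem_singleton y (fun q => long C q v), sum_ite_mem_compl_singleton,
      if_neg (Finset.notMem_empty r), mul_zero, zero_add] at hr
    rw [longProbOn_boundary C h.isLowerSystem hfin, ← hr]
    congr 1
    refine Finset.sum_congr rfl fun A _ => ?_
    rw [configWeight_eq C (topRhombus_injective v) A]
    simp only [Finset.mem_filter, Finset.mem_univ, true_and, mul_ite, mul_zero]
    rfl
  have hbot : longProbOn C (boundary (L \ {v})) q (v - unit q) =
      (y q * long C q (v - unit q) +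
        x * (long C q (v - unit q) * long C q.next (v - unit q.next) +
          long C q (v - unit q) * long C q.prev (v - unit q.prev))) /
        partitionFunction C (boundary (L \ {v})) := by
    have hr := (hg fun S => if q ∈ S then ∏ q ∈ S, long C q (v - unit q) else 0).2
    rw [sum_ite_mem_singleton y (fun q => long C q (v - unit q)),
      sum_ite_mem_compl_singleton (fun q => long C q (v - unit q)),
      if_neg (Finset.notMem_empty q), mul_zero, add_zero, add_comm] at hr
    rw [longProbOn_boundary C h.sdiff hfin', ← hr]
    congr 1
    refine Finset.sum_congr rfl fun A _ => ?_
    rw [configWeight_eq C (bottomRhombus_injective v) A]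
    simp only [Finset.mem_filter, Finset.mem_univ, true_and, mul_ite, mul_zero]
    rfl
  have hZsum : partitionFunction C (boundary L) = x + (∑ q, y q * long C q v) +
      t * ∑ q : Kind, long C q.next v * long C q.prev v := by
    have hr := (hg fun S => ∏ q ∈ S, long C q v).1
    simp only [prod_compl_singleton, Finset.prod_empty, Finset.prod_singleton, mul_one] at hr
    rw [partitionFunction_boundary C h.isLowerSystem hfin, ← hr]
    exact Finset.sum_congr rfl fun A _ => configWeight_eq C (topRhombus_injective v) A
  rw [hbot, htop q, htop .a, htop .b, htop .c, coeff_eq hC hY h.nonpos, hZ']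
  simp only [sum_kind, hlong, Kind.next, Kind.prev] at hZsum ⊢
  have hs : pairSum C v = long C .a v * long C .b v + long C .a v * long C .c v +
    long C .b v * long C .c v := rfl
  cases q
  · have := edge_probability_identity (x := x) (t := t) (y₁ := y .a) (y₂ := y .b) (y₃ := y .c)
      (α := long C .a v) (β := long C .b v) (γ := long C .c v) hs hs0
      (Z := partitionFunction C (boundary L)) (by rw [hZsum, hs]; ring) hZ
    convert this using 2; ring
  · have := edge_probability_identity (x := x) (t := t) (y₁ := y .b) (y₂ := y .a) (y₃ := y .c)
      (α := long C .b v) (β := long C .a v) (γ := long C .c v) (by rw [hs]; ring) hs0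
      (Z := partitionFunction C (boundary L)) (by rw [hZsum, hs]; ring) hZ
    convert this using 2 <;> ring
  · have := edge_probability_identity (x := x) (t := t) (y₁ := y .c) (y₂ := y .a) (y₃ := y .b)
      (α := long C .c v) (β := long C .a v) (γ := long C .b v) (by rw [hs]; ring) hs0
      (Z := partitionFunction C (boundary L)) (by rw [hZsum, hs]; ring) hZ
    convert this using 2; ring

end IsTop

/-! ### Partition functions and edge probabilities -/

section Conductance

variable {C : Sym2 Vertex → ℂ}

theorem configs_finite_and_partitionFunction_ne_zero (hC : IsConductance C)
    (hY : IsYDeltaConsistent C) {L : Set Vertex} (hL : IsLowerSystem L) :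
    (configs L).Finite ∧ partitionFunction C (boundary L) ≠ 0 := by
  refine lowerSystem_induction (P := fun L => (configs L).Finite ∧
    partitionFunction C (boundary L) ≠ 0) isLowerSystem_Iic ?_ ?_ L hL hL.nonpos
  · have hfin : (configs (Set.Iic 0)).Finite := by
      rw [configs_Iic]
      exact Set.finite_singleton _
    refine ⟨hfin, ?_⟩
    rw [partitionFunction_boundary C isLowerSystem_Iic hfin]
    have : hfin.toFinset = {∅} := by
      ext A; simp [configs_Iic]
    rw [this, Finset.sum_singleton, configWeight, Finset.prod_empty]
    exact one_ne_zero
  · rintro L v h - ⟨hfin, hZ⟩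
    rw [h.partitionFunction_eq hC hY hfin] at hZ
    exact ⟨h.finite_configs_sdiff hfin, right_ne_zero_of_mul hZ⟩

theorem isLowerSystem_standard (q : Kind) (v : Vertex) :
    IsLowerSystem {u | u ≤ 0 ∧ ¬ (v + unit q ≤ u)} := by
  refine ⟨fun u hu => hu.1, ?_, ?_⟩
  · refine (Set.finite_Icc (v + unit q) 0).subset ?_
    rintro u ⟨h0, h⟩
    refine ⟨?_, h0⟩
    by_contra h'
    exact h ⟨h0, h'⟩
  · rintro w ⟨h0, h⟩ u hu
    exact ⟨hu.trans h0, fun h' => h (h'.trans hu)⟩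

/-- The standard conditions come from the largest lower system omitting `v + unit q`. Descending
from it to `L` deletes only points other than `v`, so `(q, v)` is outside the cube at each move. -/
theorem longProbOn_boundary_eq_longProb (hC : IsConductance C) (hY : IsYDeltaConsistent C)
    {L : Set Vertex} (hL : IsLowerSystem L) {q : Kind} {v : Vertex} (hv : (q, v) ∈ rhombi L) :
    longProbOn C (boundary L) q v = longProb C q v := by
  refine lowerSystem_induction (P := fun L => v ∈ L →
    longProbOn C (boundary L) q v = longProb C q v) (isLowerSystem_standard q v)
    (fun _ => rfl) ?_ L hL ?_ hv.1
  · intro L x h hsub ih hvL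
    rw [← ih hvL.1]
    refine h.longProbOn_sdiff_of_common hC hY
      (configs_finite_and_partitionFunction_ne_zero hC hY h.isLowerSystem).1
      ⟨⟨hvL.1, fun h' => ?_⟩, hvL.2⟩
    exact (hsub h').2 le_rfl
  · exact fun u hu => ⟨hL.nonpos u hu, fun h => hv.2 (hL.lower u hu _ h)⟩

/-- The cube move is applied to the largest lower system in which `v` is maximal. By independence of
the initial conditions, all probabilities involved may be computed before and after this one move.
-/
theorem longProb_sub_unit (hC : IsConductance C) (hY : IsYDeltaConsistent C) {v : Vertex}
    (hv : v ≤ 0) (q : Kind) :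
    longProb C q (v - unit q) = longProb C q v + (1 - coeff C q v) * creationRate C v := by
  have hL : IsLowerSystem {u | u ≤ 0 ∧ ∀ q, ¬ (v + unit q ≤ u)} := by
    refine ⟨fun u hu => hu.1, ?_, ?_⟩
    · refine (Set.finite_Icc v 0).subset ?_
      rintro u ⟨h0, h⟩
      refine ⟨?_, h0⟩
      by_contra h'
      exact h ⟨h0, fun q hq => h' (le_trans (by simpa using unit_nonneg q) hq)⟩
    · rintro w ⟨h0, h⟩ u hu
      exact ⟨hu.trans h0, fun q h' => h q (h'.trans hu)⟩
  have h : IsTop {u | u ≤ 0 ∧ ∀ q, ¬ (v + unit q ≤ u)} v := by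
    refine ⟨hL, ⟨hv, fun q hq => ?_⟩, fun q hq => hq.2 q le_rfl⟩
    have hq' : unit q ≤ 0 := by simpa using hq
    exact unit_ne_zero q (le_antisymm hq' (unit_nonneg q))
  obtain ⟨hfin, hZ⟩ := configs_finite_and_partitionFunction_ne_zero hC hY hL
  have htop : ∀ r, (r, v) ∈ rhombi {u | u ≤ 0 ∧ ∀ q, ¬ (v + unit q ≤ u)} := fun r => by
    rw [h.rhombi_eq]; exact .inr ⟨r, rfl⟩
  have hbot : (q, v - unit q) ∈ rhombi ({u | u ≤ 0 ∧ ∀ q, ¬ (v + unit q ≤ u)} \ {v}) := by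
    rw [h.rhombi_sdiff_eq]; exact .inr ⟨q, rfl⟩
  have key := h.longProbOn_bottom hC hY hfin hZ q
  rwa [longProbOn_boundary_eq_longProb hC hY h.sdiff hbot,
    longProbOn_boundary_eq_longProb hC hY hL (htop q),
    longProbOn_boundary_eq_longProb hC hY hL (htop .a),
    longProbOn_boundary_eq_longProb hC hY hL (htop .b),
    longProbOn_boundary_eq_longProb hC hY hL (htop .c)] at key

/-- The rhombus lies on the boundary of the octant, whose only grove has no long diagonals. -/
theorem longProb_eq_zero (hC : IsConductance C) (hY : IsYDeltaConsistent C) {q : Kind}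
    {v : Vertex} (hv : v ≤ 0) (hq : coord q v = 0) : longProb C q v = 0 := by
  classical
  rw [← longProbOn_boundary_eq_longProb hC hY isLowerSystem_Iic (mem_rhombi_Iic.2 ⟨hv, hq⟩),
    longProbOn_boundary C isLowerSystem_Iic
      (configs_finite_and_partitionFunction_ne_zero hC hY isLowerSystem_Iic).1,
    Finset.sum_eq_zero, zero_div]
  intro A hA
  rw [Set.Finite.mem_toFinset, configs_Iic] at hA
  rw [Set.mem_singleton_iff.1 hA, if_neg (Finset.notMem_empty _)]

/-! ### Translations -/

theorem longDiag_map_add (q : Kind) (v μ : Vertex) :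
    (longDiag q v).map (· + μ) = longDiag q (v + μ) := by
  rw [longDiag_eq, longDiag_eq, Sym2.map_mk]
  simp only [sub_add_eq_add_sub]

theorem shortDiag_map_add (q : Kind) (v μ : Vertex) :
    (shortDiag q v).map (· + μ) = shortDiag q (v + μ) := by
  rw [shortDiag_eq, shortDiag_eq, Sym2.map_mk]
  simp only [sub_add_eq_add_sub]

theorem long_translate (C : Sym2 Vertex → ℂ) (μ : Vertex) (q : Kind) (v : Vertex) :
    long (translate C μ) q v = long C q (v + μ) := congrArg C (longDiag_map_add q v μ)

theorem short_translate (C : Sym2 Vertex → ℂ) (μ : Vertex) (q : Kind) (v : Vertex) :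
    short (translate C μ) q v = short C q (v + μ) := congrArg C (shortDiag_map_add q v μ)

theorem IsConductance.translate (hC : IsConductance C) {μ : Vertex} (hμ : μ ≤ 0) :
    IsConductance (translate C μ) := by
  intro q v hv
  have := hC q (v + μ) (add_nonpos hv hμ)
  rwa [← longDiag_map_add, ← shortDiag_map_add] at this

theorem IsYDeltaConsistent.translate (hY : IsYDeltaConsistent C) {μ : Vertex} (hμ : μ ≤ 0) :
    IsYDeltaConsistent (translate C μ) := by
  intro v hv
  have := hY (v + μ) (add_nonpos hv hμ)
  simpa only [pairSum, long_translate, short_translate, add_right_comm v _ μ] using this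

theorem coeff_translate (C : Sym2 Vertex → ℂ) (μ : Vertex) (q : Kind) (v : Vertex) :
    coeff (translate C μ) q v = coeff C q (v + μ) := by
  cases q <;> simp only [coeff, coeffU, coeffV, coeffW, delta, long_translate,
    add_right_comm v _ μ]

/-! ### The linear system -/

open scoped Classical in
/-- The long edge probabilities at `u` for the octant with apex `ν`, extended by zero. -/
noncomputable def apexProb (C : Sym2 Vertex → ℂ) (q : Kind) (u ν : Vertex) : ℂ :=
  if u ≤ ν then longProb (translate C ν) q (u - ν) else 0

open scoped Classical in
/-- The creation rates at `u` for the octant with apex `ν`, extended by zero. -/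
noncomputable def apexRate (C : Sym2 Vertex → ℂ) (u ν : Vertex) : ℂ :=
  if u ≤ ν then creationRate (translate C ν) (u - ν) else 0

open scoped Classical in
theorem apexRate_eq (C : Sym2 Vertex → ℂ) (u ν : Vertex) : apexRate C u ν =
    (if u ≤ ν then 1 else 0) - apexProb C .a u ν - apexProb C .b u ν - apexProb C .c u ν := by
  unfold apexRate apexProb
  split_ifs
  · rfl
  · simp

/-- After extension by zero the recursion holds at every `u`, with a coefficient independent of the
apex. If `u - unit q ≤ ν` but not `u ≤ ν`, then `u - unit q` is on the face of the octant where
`longProb_eq_zero` applies. -/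
theorem apexProb_sub_unit (hC : IsConductance C) (hY : IsYDeltaConsistent C) {ν : Vertex}
    (hν : ν ≤ 0) (q : Kind) (u : Vertex) : apexProb C q (u - unit q) ν =
      apexProb C q u ν + (1 - coeff C q u) * apexRate C u ν := by
  have hC' := hC.translate hν
  have hY' := hY.translate hν
  unfold apexRate apexProb
  by_cases hu : u ≤ ν
  · have hu' : u - unit q ≤ ν := (sub_le_self u (unit_nonneg q)).trans hu
    rw [if_pos hu, if_pos hu, if_pos hu', sub_right_comm,
      longProb_sub_unit hC' hY' (sub_nonpos.2 hu), coeff_translate, sub_add_cancel]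
  · rw [if_neg hu, if_neg hu, mul_zero, add_zero]
    split_ifs with hu'
    · refine longProb_eq_zero hC' hY' (sub_nonpos.2 hu') ?_
      by_contra hne
      rw [← ne_eq, ← add_unit_le_zero_iff (sub_nonpos.2 hu')] at hne
      refine hu (sub_nonpos.1 (le_of_eq_of_le ?_ hne))
      abel
    · rfl

/-- The linear combination of the values of `φ` at the vertices of a cube with top `μ` that
appears in the linear system. -/
noncomputable def cubeComb (C : Sym2 Vertex → ℂ) (μ : Vertex) (φ : Vertex → ℂ) : ℂ :=
  φ μ + φ (μ + (-1, -1, -1))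
    - coeff C .a μ * (φ (μ + (-1, 0, 0)) + φ (μ + (0, -1, -1)))
    - coeff C .b μ * (φ (μ + (0, -1, 0)) + φ (μ + (-1, 0, -1)))
    - coeff C .c μ * (φ (μ + (0, 0, -1)) + φ (μ + (-1, -1, 0)))

theorem cubeComb_congr {μ : Vertex} {φ ψ : Vertex → ℂ} (h : ∀ ν ≤ μ, φ ν = ψ ν) :
    cubeComb C μ φ = cubeComb C μ ψ := by
  unfold cubeComb
  rw [h μ le_rfl]
  repeat rw [h (μ + _) (add_le_of_nonpos_right (by simp [Prod.le_def]))]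

theorem cubeComb_zero (C : Sym2 Vertex → ℂ) (μ : Vertex) : cubeComb C μ (fun _ => 0) = 0 := by
  simp [cubeComb]

theorem cubeComb_apexProb_of_not_le {μ u : Vertex} (h : ¬ u ≤ μ) (q : Kind) :
    cubeComb C μ (apexProb C q u) = 0 := by
  rw [← cubeComb_zero C μ]
  exact cubeComb_congr fun ν hν => if_neg fun h' => h (h'.trans hν)

theorem cubeComb_apexRate_of_not_le {μ u : Vertex} (h : ¬ u ≤ μ) :
    cubeComb C μ (apexRate C u) = 0 := by
  rw [← cubeComb_zero C μ]
  exact cubeComb_congr fun ν hν => if_neg fun h' => h (h'.trans hν)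

theorem cubeComb_apexProb_sub_unit (hC : IsConductance C) (hY : IsYDeltaConsistent C)
    {μ : Vertex} (hμ : μ ≤ 0) (q : Kind) (u : Vertex) :
    cubeComb C μ (apexProb C q (u - unit q)) = cubeComb C μ (apexProb C q u) +
      (1 - coeff C q u) * cubeComb C μ (apexRate C u) := by
  rw [cubeComb_congr fun ν hν => apexProb_sub_unit hC hY (hν.trans hμ) q u]
  unfold cubeComb
  ring

/-- `u ≠ μ` is on the ray from `μ` in the direction `-unit q`. -/
def OnRay (q : Kind) (μ u : Vertex) : Prop :=
  coord q u < coord q μ ∧ coord q.next u = coord q.next μ ∧ coord q.prev u = coord q.prev μ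

theorem ext_coord {u v : Vertex} (h : ∀ q, coord q u = coord q v) : u = v :=
  Prod.ext (h .a) (Prod.ext (h .b) (h .c))

theorem le_iff_coord {u v : Vertex} : u ≤ v ↔ ∀ q, coord q u ≤ coord q v :=
  ⟨fun h q => by cases q; exacts [h.1, h.2.1, h.2.2], fun h => ⟨h .a, h .b, h .c⟩⟩

theorem height_mono {u v : Vertex} (h : u ≤ v) : height u ≤ height v :=
  add_le_add (add_le_add h.1 h.2.1) h.2.2

theorem coord_add_unit (q : Kind) (u : Vertex) : coord q (u + unit q) = coord q u + 1 ∧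
    coord q.next (u + unit q) = coord q.next u ∧ coord q.prev (u + unit q) = coord q.prev u := by
  cases q <;> simp [coord, unit, Kind.next, Kind.prev]

open scoped Classical in
-- The combination of the indicators of `u ≤ ν` is `1` at `μ`, `1 - coeff C q μ` on the ray of kind
-- `q`, and `0` at all other `u ≤ μ`. The probabilities cancel exactly the contributions of the
-- rays.
theorem cubeComb_apexRate_eq_of_rays (hC : IsConductance C) (hY : IsYDeltaConsistent C)
    {μ u : Vertex} (hμ : μ ≤ 0) (hu : u ≤ μ)
    (h : ∀ q, cubeComb C μ (apexProb C q u) = if OnRay q μ u then 1 - coeff C q μ else 0) :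
    cubeComb C μ (apexRate C u) = if u = μ then 1 else 0 := by
  have hsum := coeff_sum hC hY hμ
  have hcomb : cubeComb C μ (apexRate C u) = cubeComb C μ (fun ν => if u ≤ ν then 1 else 0) -
      cubeComb C μ (apexProb C .a u) - cubeComb C μ (apexProb C .b u) -
      cubeComb C μ (apexProb C .c u) := by
    rw [cubeComb_congr fun ν _ => apexRate_eq C u ν]
    unfold cubeComb
    ring
  rw [hcomb, h, h, h, cubeComb]
  obtain ⟨i, j, k⟩ := u
  obtain ⟨i', j', k'⟩ := μ
  simp only [Prod.mk_le_mk] at hu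
  simp only [OnRay, coord, Kind.next, Kind.prev, Prod.mk_le_mk, Prod.mk_add_mk, Prod.mk.injEq,
    add_zero]
  obtain ⟨hi, hj, hk⟩ := hu
  have hi' : i ≤ i' + -1 ↔ i ≠ i' := by omega
  have hj' : j ≤ j' + -1 ↔ j ≠ j' := by omega
  have hk' : k ≤ k' + -1 ↔ k ≠ k' := by omega
  have hi'' : i < i' ↔ i ≠ i' := by omega
  have hj'' : j < j' ↔ j ≠ j' := by omega
  have hk'' : k < k' ↔ k ≠ k' := by omega
  simp only [hi, hj, hk, hi', hj', hk', hi'', hj'', hk'', true_and, and_true, if_true]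
  -- Eight cases, by which coordinates of `u` and `μ` agree. With exactly one agreement the value is
  -- `1 - U - V - W`, with none it is twice that.
  by_cases ei : i = i' <;> by_cases ej : j = j' <;> by_cases ek : k = k' <;>
    simp only [ei, ej, ek, ne_eq, not_true_eq_false, not_false_eq_true, and_true, and_false,
      and_self, if_true, if_false] <;>
    first | ring1 | linear_combination -hsum | linear_combination -2 * hsum

open scoped Classical in
-- Induction downwards from `μ`: the recursion carries the combined probability of kind `q` from `u
-- + unit q` to `u` unchanged, except that the unit rate at `μ` starts a ray of value `1 - coeff C q
-- μ`.
theorem cubeComb_apex (hC : IsConductance C) (hY : IsYDeltaConsistent C) {μ : Vertex}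
    (hμ : μ ≤ 0) : ∀ (n : ℕ) (u : Vertex), height μ - height u = n → u ≤ μ →
      (∀ q, cubeComb C μ (apexProb C q u) = if OnRay q μ u then 1 - coeff C q μ else 0) ∧
        cubeComb C μ (apexRate C u) = if u = μ then 1 else 0 := by
  intro n
  induction n using Nat.strong_induction_on with
  | _ n ih =>
    intro u hn hu
    have hP : ∀ q, cubeComb C μ (apexProb C q u) =
        if OnRay q μ u then 1 - coeff C q μ else 0 := by
      intro q
      obtain ⟨e1, e2, e3⟩ := coord_add_unit q u
      have key := cubeComb_apexProb_sub_unit hC hY hμ q (u + unit q)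
      rw [add_sub_cancel_right] at key
      by_cases hle : u + unit q ≤ μ
      · have hh := height_mono hle
        rw [height_add, height_unit] at hh
        obtain ⟨h1, h2⟩ := ih (n - 1) (by omega) (u + unit q)
          (by rw [height_add, height_unit]; omega) hle
        have hq := le_iff_coord.1 hle q
        rw [key, h1, h2]
        -- The ray starts at `μ - unit q`, where the source term `(1 - coeff C q μ) * 1` enters.
        by_cases hμu : u + unit q = μ
        · rw [if_neg, if_pos hμu, if_pos, hμu, zero_add, mul_one]
          · rw [← hμu]; exact ⟨by omega, e2.symm, e3.symm⟩
          · rintro ⟨h, -, -⟩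
            rw [hμu] at h
            exact h.false
        · rw [if_neg hμu, mul_zero, add_zero]
          refine if_congr ⟨fun h => ?_, fun h => ?_⟩ rfl rfl
          · exact ⟨by have := h.1; omega, e2 ▸ h.2.1, e3 ▸ h.2.2⟩
          · refine ⟨lt_of_le_of_ne hq fun e => hμu (ext_coord fun r => ?_), e2.trans h.2.1,
              e3.trans h.2.2⟩
            rcases q.eq_or r with rfl | rfl | rfl
            exacts [e, e2.trans h.2.1, e3.trans h.2.2]
      · rw [key, cubeComb_apexProb_of_not_le hle, cubeComb_apexRate_of_not_le hle, mul_zero,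
          add_zero, if_neg]
        rintro ⟨h1, h2, h3⟩
        refine hle (le_iff_coord.2 fun r => ?_)
        rcases q.eq_or r with rfl | rfl | rfl <;> omega
    exact ⟨hP, cubeComb_apexRate_eq_of_rays hC hY hμ hu hP⟩

/-! ### Generating functions -/

/-- The exponent `n` as a lattice point. -/
def exponent (n : Fin 3 →₀ ℕ) : Vertex := ((n 0 : ℤ), (n 1 : ℤ), (n 2 : ℤ))

theorem exponent_le_iff {m n : Fin 3 →₀ ℕ} : exponent m ≤ exponent n ↔ m ≤ n := by
  simp [exponent, Finsupp.le_def, Fin.forall_fin_succ]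

/-- Multiplying by the monomial `m` compensates the shift of the apex by `-m`, so that all eight
terms of the system are read at the same absolute point `μ - exponent n`. The extension by zero
accounts for the exponents `n` not above `m`. -/
theorem coeff_monomial_mul_genFun (C : Sym2 Vertex → ℂ) {μ ν : Vertex} {m : Fin 3 →₀ ℕ}
    (hν : ν = μ - exponent m) (n : Fin 3 →₀ ℕ) :
    MvPowerSeries.coeff n (MvPowerSeries.monomial m 1 * genFun C ν) =
      apexRate C (μ - exponent n) ν := by
  classical
  subst hν
  rw [MvPowerSeries.coeff_monomial_mul, one_mul, apexRate]
  have hiff : μ - exponent n ≤ μ - exponent m ↔ m ≤ n := by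
    rw [sub_le_sub_iff_left, exponent_le_iff]
  by_cases hmn : m ≤ n
  · rw [if_pos hmn, if_pos (hiff.2 hmn), MvPowerSeries.coeff_apply, genFun]
    congr 1
    have h0 := hmn 0
    have h1 := hmn 1
    have h2 := hmn 2
    simp only [exponent, Finsupp.tsub_apply, Nat.cast_sub h0, Nat.cast_sub h1, Nat.cast_sub h2]
    refine Prod.ext ?_ (Prod.ext ?_ ?_) <;> simp
  · rw [if_neg hmn, if_neg fun h => hmn (hiff.1 h)]

end Conductance

end Groves

/-! ### The theorem -/

theorem theorem2p8 (C : Sym2 Groves.Vertex → ℂ)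
    (hC : Groves.IsConductance C) (hY : Groves.IsYDeltaConsistent C) :
    -- the Boltzmann weights are well defined on every set of initial conditions
    (∀ I : Set Groves.Vertex, Groves.IsInitialConditions I →
      (Groves.groves I).Finite ∧ Groves.partitionFunction C I ≠ 0) ∧
    -- the edge probabilities do not depend on the set of initial conditions
    (∀ (q : Groves.Kind) (v : Groves.Vertex), v ≤ 0 →
      ∀ I : Set Groves.Vertex, Groves.IsInitialConditions I → Groves.rhombus q v ⊆ I →
        Groves.longProbOn C I q v = Groves.longProb C q v) ∧
    -- the linear system
    (∀ μ : Groves.Vertex, μ ≤ 0 →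
      let F : Groves.Vertex → MvPowerSeries (Fin 3) ℂ := Groves.genFun C
      let x : MvPowerSeries (Fin 3) ℂ := MvPowerSeries.X 0
      let y : MvPowerSeries (Fin 3) ℂ := MvPowerSeries.X 1
      let z : MvPowerSeries (Fin 3) ℂ := MvPowerSeries.X 2
      let U : ℂ := Groves.coeffU (Groves.translate C μ) 0
      let V : ℂ := Groves.coeffV (Groves.translate C μ) 0
      let W : ℂ := Groves.coeffW (Groves.translate C μ) 0
      F μ + x * y * z * F (μ + (-1, -1, -1))
        - U • (x * F (μ + (-1, 0, 0)) + y * z * F (μ + (0, -1, -1)))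
        - V • (y * F (μ + (0, -1, 0)) + x * z * F (μ + (-1, 0, -1)))
        - W • (z * F (μ + (0, 0, -1)) + x * y * F (μ + (-1, -1, 0))) = 1) := by
  refine ⟨?_, ?_, ?_⟩
  · rintro _ ⟨L, hL, rfl⟩
    obtain ⟨hfin, hZ⟩ := Groves.configs_finite_and_partitionFunction_ne_zero hC hY hL
    refine ⟨?_, hZ⟩
    rw [Groves.groves_boundary hL]
    exact hfin.image _
  · rintro q v - _ ⟨L, hL, rfl⟩ hsub
    exact Groves.longProbOn_boundary_eq_longProb hC hY hL
      ((Groves.rhombus_subset_boundary_iff hL q v).1 hsub)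
  · intro μ hμ F x y z U V W
    classical
    have hU : U = Groves.coeff C .a μ :=
      (Groves.coeff_translate C μ .a 0).trans (by rw [zero_add])
    have hV : V = Groves.coeff C .b μ :=
      (Groves.coeff_translate C μ .b 0).trans (by rw [zero_add])
    have hW : W = Groves.coeff C .c μ :=
      (Groves.coeff_translate C μ .c 0).trans (by rw [zero_add])
    ext n
    have hle : μ - Groves.exponent n ≤ μ :=
      sub_le_self μ (by simp [Groves.exponent, Prod.le_def])
    -- The coefficient at `n` is the cube combination of rates at `μ - exponent n`, which lies `n 0
    -- + n 1 + n 2` levels below `μ`.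
    have key := (Groves.cubeComb_apex hC hY hμ (n 0 + n 1 + n 2) (μ - Groves.exponent n)
      (by rw [Groves.height_sub]; simp [Groves.exponent, Groves.height]) hle).2
    have hcoeff := fun (m : Fin 3 →₀ ℕ) (ν : Groves.Vertex) (hν : ν = μ - Groves.exponent m) =>
      Groves.coeff_monomial_mul_genFun C hν n
    have h0 := hcoeff 0 μ (by rw [show Groves.exponent 0 = 0 from rfl, sub_zero])
    have hx := hcoeff (Finsupp.single 0 1) (μ + (-1, 0, 0))
      (by rw [sub_eq_add_neg]; simp [Groves.exponent])
    have hy := hcoeff (Finsupp.single 1 1) (μ + (0, -1, 0))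
      (by rw [sub_eq_add_neg]; simp [Groves.exponent])
    have hz := hcoeff (Finsupp.single 2 1) (μ + (0, 0, -1))
      (by rw [sub_eq_add_neg]; simp [Groves.exponent])
    have hyz := hcoeff (Finsupp.single 1 1 + Finsupp.single 2 1) (μ + (0, -1, -1))
      (by rw [sub_eq_add_neg]; simp [Groves.exponent])
    have hxz := hcoeff (Finsupp.single 0 1 + Finsupp.single 2 1) (μ + (-1, 0, -1))
      (by rw [sub_eq_add_neg]; simp [Groves.exponent])
    have hxy := hcoeff (Finsupp.single 0 1 + Finsupp.single 1 1) (μ + (-1, -1, 0))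
      (by rw [sub_eq_add_neg]; simp [Groves.exponent])
    have hxyz := hcoeff (Finsupp.single 0 1 + Finsupp.single 1 1 + Finsupp.single 2 1)
      (μ + (-1, -1, -1)) (by rw [sub_eq_add_neg]; simp [Groves.exponent])
    have hmul : ∀ m m' : Fin 3 →₀ ℕ, (MvPowerSeries.monomial (m + m') 1 : MvPowerSeries (Fin 3) ℂ) =
        MvPowerSeries.monomial m 1 * MvPowerSeries.monomial m' 1 := fun m m' => by
      rw [MvPowerSeries.monomial_mul_monomial, one_mul]
    simp only [hmul, MvPowerSeries.monomial_zero_one, one_mul] at h0 hx hy hz hyz hxz hxy hxyz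
    rw [Groves.cubeComb] at key
    simp only [F, x, y, z, MvPowerSeries.X_def, map_sub, map_add, MvPowerSeries.coeff_smul,
      h0, hx, hy, hz, hyz, hxz, hxy, hxyz, hU, hV, hW, key, MvPowerSeries.coeff_one]
    refine if_congr ⟨fun h => ?_, fun h => ?_⟩ rfl rfl
    · have h' : Groves.exponent n = 0 := by simpa using h
      simp only [Groves.exponent, Prod.mk_eq_zero, Nat.cast_eq_zero] at h'
      ext i
      fin_cases i
      exacts [h'.1, h'.2.1, h'.2.2]
    · simp [h, Groves.exponent]
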